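/- Let $\mathcal P$ be a finite-dimensional smooth manifold (Hausdorff, second countable, without boundary), let $\omega$ be a presymplectic form on $\mathcal P$ (a smooth closed 2-form, possibly degenerate), and let $\mathcal C\subset\mathcal P$ be a smooth embedded submanifold, for instance the final constraint submanifold of a Hamiltonian system on $(\mathcal P,\omega)$. For a subspace $W\subset T_p\mathcal P$ let $W^\perp=\{V\in T_p\mathcal P:\omega(V,W')=0\text{ for all }W'\in W\}$; write $T\mathcal P^\perp$ and $T\mathcal C^\perp$ for the families $(T_p\mathcal P)^\perp$ and $(T_p\mathcal C)^\perp$, $p\in\mathcal C$. For a smooth function $f$ and a family $W$ of subspaces, $W[f]=0$ means that $df$ vanishes on every vector of $W$. A *constraint* is a smooth function $f:\mathcal P\to\mathbb R$ that vanishes on $\mathcal C$; it is *first class* if $T\mathcal C^\perp[f]=0$ everywhere on $\mathcal C$. A vector $V\in T_p\mathcal P$ is a *Hamiltonian vector of $f$ at $p$* if $\mathbf i_V\omega_p=df(p)$. A *Hamiltonian vector field of $f$ along $\mathcal C$* is a smooth section $X_f$ of $T\mathcal P|_{\mathcal C}$ with $\mathbf i_{X_f}\omega=df$ at all points of $\mathcal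 C$ (it is determined only up to $\ker\omega=T\mathcal P^\perp$). A family of subspaces of the spaces $T_p\mathcal P$, $p\in\mathcal C$, is *regular near* $p\in\mathcal C$ if its dimension is constant on a neighbourhood of $p$ in $\mathcal C$, and *regular* if it is regular near every point of $\mathcal C$. Then: (i) Let $f$ be a constraint. Then $f$ has a Hamiltonian vector at every point of $\mathcal C$ if and only if $T\mathcal P^\perp[f]|_{\mathcal C}=0$; if $T\mathcal P^\perp|_{\mathcal C}$ is regular, then $f$ has a Hamiltonian vector field along $\mathcal C$ if and only if $T\mathcal P^\perp[f]|_{\mathcal C}=0$. Every Hamiltonian vector of $f$ at a point $p\in\mathcal C$ lies in $T_p\mathcal C^\perp$. (ii) At every point $p\in\mathcal C$, $T_p\mathcal C^\perp$ is spanned by the Hamiltonian vectors at $p$ of constraints; if $T\mathcal C^\perp$ is regular near $p$, then $T_p\mathcal C^\perp$ is spanned by the values at $p$ of the Hamiltonian vector fields along $\mathcal C$ of constraints. (iii) Let $f$ be a first class constraint. Then at every point $p\in\mathcal C$ it has a Hamiltonian vector lying in $T_p\mathcal C\cap T_p\mathcal C^\perp$; if $T\mathcal C^\perp$ is regular, then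 $f$ has a Hamiltonian vector field along $\mathcal C$ that is a smooth vector field on $\mathcal C$ (everywhere tangent to $\mathcal C$) and takes its values in $T\mathcal C\cap T\mathcal C^\perp$. (iv) At every point $p\in\mathcal C$ near which $T\mathcal C\cap T\mathcal C^\perp$ is regular, $T_p\mathcal C\cap T_p\mathcal C^\perp$ is spanned by the values at $p$ of those Hamiltonian vector fields along $\mathcal C$ of first class constraints that are smooth vector fields on $\mathcal C$. -/

import Mathlib

open Set Filter Topology Manifold
open scoped ContDiff

noncomputable section

/-- A (not necessarily smooth) 2-form on a manifold `P` modelled on `E`. -/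
abbrev TwoForm (E : Type*) [NormedAddCommGroup E] [NormedSpace ℝ E]
    (P : Type*) [TopologicalSpace P] [ChartedSpace E P] :=
  ∀ p : P, TangentSpace 𝓘(ℝ, E) p [⋀^Fin 2]→L[ℝ] ℝ

/-- The local representative of a 2-form in the preferred chart `φ` at `x`, that is, the
pullback `(φ⁻¹)^* Ω`, a 2-form on the vector space `E` (meaningful on the open set `φ.target`). -/
def TwoForm.inChart {E : Type*} [NormedAddCommGroup E] [NormedSpace ℝ E]
    {P : Type*} [TopologicalSpace P] [ChartedSpace E P]
    (Ω : TwoForm E P) (x : P) (y : E) : E [⋀^Fin 2]→L[ℝ] ℝ :=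
  (Ω ((extChartAt 𝓘(ℝ, E) x).symm y)).compContinuousLinearMap
    (mfderiv 𝓘(ℝ, E) 𝓘(ℝ, E) (extChartAt 𝓘(ℝ, E) x).symm y)

/-- A presymplectic form: a smooth closed 2-form, possibly degenerate. Smoothness and closedness
(`d Ω = 0`) are expressed in the charts of the manifold. -/
structure PresymplecticForm (E : Type*) [NormedAddCommGroup E] [NormedSpace ℝ E]
    (P : Type*) [TopologicalSpace P] [ChartedSpace E P] where
  /-- The underlying 2-form. -/
  form : TwoForm E P
  smooth : ∀ x : P, ContDiffOn ℝ ∞ (form.inChart x) (extChartAt 𝓘(ℝ, E) x).target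
  closed : ∀ x : P, ∀ y ∈ (extChartAt 𝓘(ℝ, E) x).target, extDeriv (form.inChart x) y = 0

section

variable {E : Type*} [NormedAddCommGroup E] [NormedSpace ℝ E]
  {P : Type*} [TopologicalSpace P] [ChartedSpace E P]
  {F : Type*} [NormedAddCommGroup F] [NormedSpace ℝ F]
  {C : Type*} [TopologicalSpace C] [ChartedSpace F C]

/-- The symplectic polar `W^⊥ = {V ∈ T_p P | Ω(V, W') = 0 for all W' ∈ W}` of a subspace `W`
of `T_p P`. -/
def PresymplecticForm.polar (Ω : PresymplecticForm E P) {p : P}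
    (W : Submodule ℝ (TangentSpace 𝓘(ℝ, E) p)) : Submodule ℝ (TangentSpace 𝓘(ℝ, E) p) where
  carrier := {V | ∀ W' ∈ W, Ω.form p ![V, W'] = 0}
  add_mem' {a b} ha hb W' hW' := by
    rw [(Ω.form p).vecCons_add, ha W' hW', hb W' hW', add_zero]
  zero_mem' W' _ := (Ω.form p).map_coord_zero 0 rfl
  smul_mem' c a ha W' hW' := by
    rw [(Ω.form p).vecCons_smul, ha W' hW', smul_zero]

/-- The tangent space at `q` of the submanifold `ι : C → P`, as a subspace of `T_{ι q} P`. -/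
def subTangent (ι : C → P) (q : C) : Submodule ℝ (TangentSpace 𝓘(ℝ, E) (ι q)) :=
  LinearMap.range (mfderiv 𝓘(ℝ, F) 𝓘(ℝ, E) ι q).toLinearMap

/-- `V ∈ T_p P` solves `i_V Ω = d f` at the point `p`: `Ω(V, W) = df(W)` for all `W ∈ T_p P`. -/
def PresymplecticForm.IsHamiltonianVector (Ω : PresymplecticForm E P) (f : P → ℝ) {p : P}
    (V : TangentSpace 𝓘(ℝ, E) p) : Prop :=
  ∀ W : TangentSpace 𝓘(ℝ, E) p, Ω.form p ![V, W] = mvfderiv 𝓘(ℝ, E) f p W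

/-- `W[f] = 0` for a subspace `W` of `T_p P`: the derivative of `f` along each vector of `W`
vanishes. -/
def DerivVanishesOn (f : P → ℝ) {p : P} (W : Submodule ℝ (TangentSpace 𝓘(ℝ, E) p)) : Prop :=
  ∀ V ∈ W, mvfderiv 𝓘(ℝ, E) f p V = 0

variable (E) in
/-- A constraint: a smooth function on `P` that vanishes on the submanifold `ι : C → P`. -/
structure IsConstraint (ι : C → P) (f : P → ℝ) : Prop where
  smooth : ContMDiff 𝓘(ℝ, E) 𝓘(ℝ, ℝ) ∞ f
  vanishes : ∀ q : C, f (ι q) = 0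

/-- A first class constraint: a constraint `f` with `TC^⊥[f] = 0` everywhere on `C`. -/
structure PresymplecticForm.IsFirstClass (Ω : PresymplecticForm E P) (F : Type*)
    [NormedAddCommGroup F] [NormedSpace ℝ F] [ChartedSpace F C] (ι : C → P) (f : P → ℝ) : Prop
    extends IsConstraint E ι f where
  firstClass : ∀ q : C, DerivVanishesOn f (Ω.polar (subTangent (F := F) ι q))

variable (F) in
/-- `X` is a smooth vector field along `C` (a smooth section of `TP` over `C`) with
`i_X Ω = d f` at the points of `C`: a Hamiltonian vector field of `f` along `C`. -/
structure PresymplecticForm.IsHamiltonianFieldAlong [IsManifold 𝓘(ℝ, E) ∞ P]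
    (Ω : PresymplecticForm E P) (ι : C → P)
    (f : P → ℝ) (X : ∀ q : C, TangentSpace 𝓘(ℝ, E) (ι q)) : Prop where
  smooth : ContMDiff 𝓘(ℝ, F) 𝓘(ℝ, E).tangent ∞
    (fun q => (⟨ι q, X q⟩ : TangentBundle 𝓘(ℝ, E) P))
  hamiltonian : ∀ q : C, Ω.IsHamiltonianVector f (X q)

/-- `Y` is a smooth vector field on the manifold `C`. -/
def IsSmoothField [IsManifold 𝓘(ℝ, F) ∞ C] (Y : ∀ q : C, TangentSpace 𝓘(ℝ, F) q) : Prop :=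
  ContMDiff 𝓘(ℝ, F) 𝓘(ℝ, F).tangent ∞ (fun q => (⟨q, Y q⟩ : TangentBundle 𝓘(ℝ, F) C))

/-- The vector field on `C` seen as a vector field along `C` with values in `TP`. -/
def pushField (ι : C → P) (Y : ∀ q : C, TangentSpace 𝓘(ℝ, F) q) (q : C) :
    TangentSpace 𝓘(ℝ, E) (ι q) :=
  mfderiv 𝓘(ℝ, F) 𝓘(ℝ, E) ι q (Y q)

/-- A family of subspaces `D q ⊆ T_{ι q} P` has constant dimension near the point `q` of `C`. -/
def HasConstantRankNear (ι : C → P) (D : ∀ q : C, Submodule ℝ (TangentSpace 𝓘(ℝ, E) (ι q)))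
    (q : C) : Prop :=
  ∀ᶠ q' in 𝓝 q, Module.finrank ℝ (D q') = Module.finrank ℝ (D q)

end

end

/-!
Let `η` be a smooth 2-form. In local frames of `TP` and of a family `W` of subspaces along the
submanifold, the equation `i_X η = d f` with `X ∈ W` is a linear system. At each point it is
solvable if and only if `W^⊥[f] = 0`, and its rank is the codimension of `W^⊥`; where the rank is
constant the system has smooth local solutions, and smooth kernel sections through every kernel
vector. The solution sets are affine, so a partition of unity glues local solutions into global
ones; `W = TP` gives (i) and `W = TC` gives (iii).

Conversely, the covector `i_X η` of a local section `X` of `TC^⊥` annihilates `TC`. Extending it by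
a retraction onto the submanifold produces a local constraint with derivative `i_X η`, and
multiplication by a bump function `ρ` makes it global, with Hamiltonian field `ρ X`. This gives
(ii), and (iv) when `X` is tangent to the submanifold.
-/

theorem injOn_range_of_surjective_comp {𝕜 G H R : Type*} [DivisionRing 𝕜] [AddCommGroup G]
    [Module 𝕜 G] [FiniteDimensional 𝕜 G] [AddCommGroup H] [Module 𝕜 H] [AddCommGroup R]
    [Module 𝕜 R] [FiniteDimensional 𝕜 R] {A : G →ₗ[𝕜] H} {p : H →ₗ[𝕜] R}
    (hp : Function.Surjective (p ∘ₗ A))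
    (hrank : Module.finrank 𝕜 (LinearMap.range A) = Module.finrank 𝕜 R) :
    InjOn p (LinearMap.range A) := by
  have hsurj : Function.Surjective (p.domRestrict (LinearMap.range A)) := fun r => by
    obtain ⟨v, hv⟩ := hp r
    exact ⟨⟨A v, LinearMap.mem_range_self A v⟩, hv⟩
  exact injOn_iff_injective.2
    ((LinearMap.injective_iff_surjective_of_finrank_eq_finrank hrank).2 hsurj)

section Analysis

variable {𝕜 : Type*} [NontriviallyNormedField 𝕜] [CompleteSpace 𝕜]
  {F : Type*} [NormedAddCommGroup F] [NormedSpace 𝕜 F] {B : Type*} [TopologicalSpace B]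
  {I : ModelWithCorners 𝕜 F B} {C : Type*} [TopologicalSpace C] [ChartedSpace B C]
  {G : Type*} [NormedAddCommGroup G] [NormedSpace 𝕜 G] [FiniteDimensional 𝕜 G]
  {H : Type*} [NormedAddCommGroup H] [NormedSpace 𝕜 H] {n : WithTop ℕ∞} {c₀ : C}

theorem contMDiffAt_clm_of_apply {A : C → G →L[𝕜] H}
    (hA : ∀ u, ContMDiffAt I 𝓘(𝕜, H) n (fun c => A c u) c₀) :
    ContMDiffAt I 𝓘(𝕜, G →L[𝕜] H) n A c₀ := by
  let b := Module.finBasis 𝕜 G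
  let k (i) : H →L[𝕜] G →L[𝕜] H :=
    ContinuousLinearMap.smulRightL 𝕜 G H (LinearMap.toContinuousLinearMap (b.coord i))
  have hsum : A = fun c => ∑ i, k i (A c (b i)) := by
    funext c
    ext u
    calc A c u = A c (∑ i, b.repr u i • b i) := by rw [b.sum_repr]
      _ = ∑ i, b.repr u i • A c (b i) := by simp only [map_sum, map_smul]
      _ = _ := by simp [k]
  rw [hsum]
  exact contMDiffAt_finsetSum fun i _ => (k i).contMDiff.contMDiffAt.comp c₀ (hA (b i))

theorem contMDiffAt_linearMap_apply {A : C → G →ₗ[𝕜] H} {u : C → G}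
    (hA : ∀ v, ContMDiffAt I 𝓘(𝕜, H) n (fun c => A c v) c₀)
    (hu : ContMDiffAt I 𝓘(𝕜, G) n u c₀) :
    ContMDiffAt I 𝓘(𝕜, H) n (fun c => A c (u c)) c₀ :=
  (contMDiffAt_clm_of_apply (A := fun c => LinearMap.toContinuousLinearMap (A c)) hA).clm_apply hu

variable [FiniteDimensional 𝕜 H] {A : C → G →ₗ[𝕜] H}

/-- On a complement of the kernel of `A c₀`, followed by a projection onto its range, the system
is invertible at `c₀`, hence near `c₀`; constancy of the rank makes the projection injective on
the nearby ranges. -/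
theorem exists_local_solution {b : C → H}
    (hA : ∀ᶠ c in 𝓝 c₀, ∀ u, ContMDiffAt I 𝓘(𝕜, H) n (fun c => A c u) c)
    (hb : ∀ᶠ c in 𝓝 c₀, ContMDiffAt I 𝓘(𝕜, H) n b c)
    (hrank : ∀ᶠ c in 𝓝 c₀, Module.finrank 𝕜 (LinearMap.range (A c)) =
      Module.finrank 𝕜 (LinearMap.range (A c₀)))
    (hrange : ∀ᶠ c in 𝓝 c₀, b c ∈ LinearMap.range (A c)) :
    ∃ v : C → G, (∀ᶠ c in 𝓝 c₀, ContMDiffAt I 𝓘(𝕜, G) n v c) ∧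
      (∀ᶠ c in 𝓝 c₀, A c (v c) = b c) ∧ (b c₀ = 0 → v c₀ = 0) := by
  let R := LinearMap.range (A c₀)
  have : CompleteSpace R := FiniteDimensional.complete 𝕜 R
  obtain ⟨i, hi⟩ := (A c₀).rangeRestrict.exists_rightInverse_of_surjective
    (LinearMap.range_rangeRestrict _)
  obtain ⟨p, hp⟩ := R.subtype.exists_leftInverse_of_injective (Submodule.ker_subtype R)
  let M (c : C) : R →L[𝕜] R := LinearMap.toContinuousLinearMap (p ∘ₗ A c ∘ₗ i)
  have hM₀ : M c₀ = ContinuousLinearEquiv.refl 𝕜 R := by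
    ext1 r
    change p (A c₀ (i r)) = r
    rw [show A c₀ (i r) = r from congrArg Subtype.val (LinearMap.congr_fun hi r)]
    exact LinearMap.congr_fun hp r
  have hp_smooth := (LinearMap.toContinuousLinearMap p).contMDiff (n := n)
  have hi_smooth := (LinearMap.toContinuousLinearMap i).contMDiff (n := n)
  have hM : ∀ᶠ c in 𝓝 c₀, ContMDiffAt I 𝓘(𝕜, R →L[𝕜] R) n M c := by
    filter_upwards [hA] with c hc
    exact contMDiffAt_clm_of_apply fun r => hp_smooth.contMDiffAt.comp c (hc (i r))
  have hinv : ∀ᶠ c in 𝓝 c₀, (M c).IsInvertible := by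
    have hcont : ContinuousAt M c₀ := hM.self_of_nhds.continuousAt
    exact hcont.eventually (hM₀ ▸ (ContinuousLinearEquiv.refl 𝕜 R).nhds)
  refine ⟨fun c => i ((M c).inverse (p (b c))), ?_, ?_, fun h => by simp [h]⟩
  · filter_upwards [hM, hinv, hb] with c hMc hinvc hbc
    have hinverse : ContMDiffAt I 𝓘(𝕜, R →L[𝕜] R) n (fun c => (M c).inverse) c :=
      hinvc.contDiffAt_map_inverse.contMDiffAt.comp c hMc
    exact hi_smooth.contMDiffAt.comp c (hinverse.clm_apply (hp_smooth.contMDiffAt.comp c hbc))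
  · filter_upwards [hinv, hrank, hrange] with c ⟨e, he⟩ hrankc hrangec
    have hMinv (r : R) : p (A c (i ((M c).inverse r))) = r := by
      change M c ((M c).inverse r) = r
      rw [← he]
      simp
    exact injOn_range_of_surjective_comp (fun r => ⟨_, hMinv r⟩) hrankc
      (LinearMap.mem_range_self _ _) hrangec (hMinv _)

theorem exists_local_kernel_section
    (hA : ∀ᶠ c in 𝓝 c₀, ∀ u, ContMDiffAt I 𝓘(𝕜, H) n (fun c => A c u) c)
    (hker : ∀ᶠ c in 𝓝 c₀, Module.finrank 𝕜 (LinearMap.ker (A c)) =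
      Module.finrank 𝕜 (LinearMap.ker (A c₀)))
    {v₀ : G} (hv₀ : A c₀ v₀ = 0) :
    ∃ v : C → G, (∀ᶠ c in 𝓝 c₀, ContMDiffAt I 𝓘(𝕜, G) n v c) ∧
      (∀ᶠ c in 𝓝 c₀, A c (v c) = 0) ∧ v c₀ = v₀ := by
  have hrank : ∀ᶠ c in 𝓝 c₀, Module.finrank 𝕜 (LinearMap.range (A c)) =
      Module.finrank 𝕜 (LinearMap.range (A c₀)) := hker.mono fun c hc => by
    have := (A c).finrank_range_add_finrank_ker
    have := (A c₀).finrank_range_add_finrank_ker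
    omega
  obtain ⟨w, hw, hAw, hw₀⟩ := exists_local_solution (b := fun c => A c v₀) hA
    (hA.mono fun c hc => hc v₀) hrank (Eventually.of_forall fun c => LinearMap.mem_range_self _ _)
  refine ⟨fun c => v₀ - w c, hw.mono fun c hc => contMDiffAt_const.sub hc, ?_, by simp [hw₀ hv₀]⟩
  filter_upwards [hAw] with c hc
  rw [map_sub, hc, sub_self]

end Analysis

theorem mfderiv_mfderiv_of_eventually_leftInverse {𝕜 E A F B : Type*} [NontriviallyNormedField 𝕜]
    [NormedAddCommGroup E] [NormedSpace 𝕜 E] [TopologicalSpace A] {I' : ModelWithCorners 𝕜 E A}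
    [NormedAddCommGroup F] [NormedSpace 𝕜 F] [TopologicalSpace B] {I : ModelWithCorners 𝕜 F B}
    {P C : Type*} [TopologicalSpace P] [ChartedSpace A P] [TopologicalSpace C] [ChartedSpace B C]
    {ι : C → P} {r : P → C} {c : C} (hr : MDifferentiableAt I' I r (ι c))
    (hι : MDifferentiableAt I I' ι c) (hrι : ∀ᶠ c' in 𝓝 c, r (ι c') = c')
    (v : TangentSpace I c) :
    (mfderiv I' I r (ι c) (mfderiv I I' ι c v) : F) = v := by
  have hderiv := (show r ∘ ι =ᶠ[𝓝 c] id from hrι).mfderiv_eq (I := I) (I' := I)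
  rw [mfderiv_comp c hr hι, mfderiv_id] at hderiv
  exact congrArg (fun L : F →L[𝕜] F => L v) hderiv

section Retraction

variable {𝕜 : Type*} [NontriviallyNormedField 𝕜]
  {E : Type*} [NormedAddCommGroup E] [NormedSpace 𝕜 E]
  {P : Type*} [TopologicalSpace P] [ChartedSpace E P]
  {F : Type*} [NormedAddCommGroup F] [NormedSpace 𝕜 F]
  {C : Type*} [TopologicalSpace C] [ChartedSpace F C]
  {n : WithTop ℕ∞} {ι : C → P}

/-- In the charts of an immersion, `ι` is `u ↦ (u, 0)`, with the left inverse `(u, w) ↦ u`. -/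
theorem exists_local_retraction (hι : IsSmoothEmbedding 𝓘(𝕜, F) 𝓘(𝕜, E) n ι) (q : C) :
    ∃ (U : Set P) (r : P → C), IsOpen U ∧ ι q ∈ U ∧ ContMDiffOn 𝓘(𝕜, E) 𝓘(𝕜, F) n r U ∧
      ∀ c, ι c ∈ U → r (ι c) = c := by
  have h := hι.isImmersion.isImmersionAt q
  obtain ⟨U₀, hU₀, hU₀_preimage⟩ := hι.isEmbedding.isOpen_iff.1 h.domChart.open_source
  let s : P → F := fun p => (h.equiv.symm (h.codChart p)).1
  have hsι (c : C) (hc : c ∈ h.domChart.source) : s (ι c) = h.domChart c := by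
    have hc' : h.domChart c ∈ (h.domChart.extend 𝓘(𝕜, F)).target := by
      simpa using h.domChart.map_source hc
    have hwritten : h.codChart (ι c) = h.equiv (h.domChart c, 0) := by
      simpa [h.domChart.left_inv hc] using h.writtenInCharts hc'
    simp [s, hwritten]
  have hs : ContMDiffOn 𝓘(𝕜, E) 𝓘(𝕜, F) n s h.codChart.source :=
    (contDiff_fst.comp h.equiv.symm.contDiff).contMDiff.comp_contMDiffOn
      (contMDiffOn_of_mem_maximalAtlas h.codChart_mem_maximalAtlas)
  refine ⟨U₀ ∩ (h.codChart.source ∩ s ⁻¹' h.domChart.target), fun p => h.domChart.symm (s p),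
    hU₀.inter (hs.continuousOn.isOpen_inter_preimage h.codChart.open_source
      h.domChart.open_target), ⟨?_, ?_, ?_⟩, ?_, fun c hc => ?_⟩
  · exact hU₀_preimage.symm.subset h.mem_domChart_source
  · exact h.source_subset_preimage_source h.mem_domChart_source
  · rw [mem_preimage, hsι q h.mem_domChart_source]
    exact h.domChart.map_source h.mem_domChart_source
  · exact (contMDiffOn_symm_of_mem_maximalAtlas h.domChart_mem_maximalAtlas).comp
      (hs.mono fun p hp => hp.2.1) fun p hp => hp.2.2
  · have hc' : c ∈ h.domChart.source := hU₀_preimage.subset hc.1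
    simp only [hsι c hc', h.domChart.left_inv hc']

theorem mfderiv_injective_of_isSmoothEmbedding (hι : IsSmoothEmbedding 𝓘(𝕜, F) 𝓘(𝕜, E) n ι)
    (hn : n ≠ 0) (c : C) : Function.Injective (mfderiv 𝓘(𝕜, F) 𝓘(𝕜, E) ι c) := by
  obtain ⟨U, r, hU, hcU, hr, hrι⟩ := exists_local_retraction hι c
  have hU_nhds := hU.mem_nhds hcU
  exact Function.LeftInverse.injective
    (g := fun W => (mfderiv 𝓘(𝕜, E) 𝓘(𝕜, F) r (ι c) W : F)) fun v =>
      mfderiv_mfderiv_of_eventually_leftInverse ((hr.contMDiffAt hU_nhds).mdifferentiableAt hn)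
        (hι.contMDiff.mdifferentiableAt hn)
        ((hι.contMDiff.continuous.continuousAt.eventually hU_nhds).mono hrι) v

end Retraction

noncomputable section

section Coordinates

variable {E : Type*} [NormedAddCommGroup E] [NormedSpace ℝ E]
  {P : Type*} [TopologicalSpace P] [ChartedSpace E P] [IsManifold 𝓘(ℝ, E) ∞ P]
  {F : Type*} [NormedAddCommGroup F] [NormedSpace ℝ F]
  {C : Type*} [TopologicalSpace C] [ChartedSpace F C]
  {p₀ p : P}

/-- The components of tangent vectors at `p` in the preferred chart at `p₀`. -/
def toCoord (p₀ p : P) : TangentSpace 𝓘(ℝ, E) p →L[ℝ] E :=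
  (trivializationAt E (TangentSpace 𝓘(ℝ, E)) p₀).continuousLinearMapAt ℝ p

/-- The tangent vector at `p` with given components in the preferred chart at `p₀`. -/
def ofCoord (p₀ p : P) : E →L[ℝ] TangentSpace 𝓘(ℝ, E) p :=
  (trivializationAt E (TangentSpace 𝓘(ℝ, E)) p₀).symmL ℝ p

theorem toCoord_ofCoord (hp : p ∈ (chartAt E p₀).source) (v : E) :
    toCoord p₀ p (ofCoord p₀ p v) = v :=
  (trivializationAt E (TangentSpace 𝓘(ℝ, E)) p₀).continuousLinearMapAt_symmL hp v

theorem ofCoord_toCoord (hp : p ∈ (chartAt E p₀).source) (V : TangentSpace 𝓘(ℝ, E) p) :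
    ofCoord p₀ p (toCoord p₀ p V) = V :=
  (trivializationAt E (TangentSpace 𝓘(ℝ, E)) p₀).symmL_continuousLinearMapAt hp V

theorem toCoord_eq_mfderiv (hp : p ∈ (chartAt E p₀).source) :
    toCoord p₀ p = mfderiv 𝓘(ℝ, E) 𝓘(ℝ, E) (extChartAt 𝓘(ℝ, E) p₀) p :=
  TangentBundle.continuousLinearMapAt_trivializationAt hp

theorem ofCoord_eq_mfderiv (hp : p ∈ (chartAt E p₀).source) :
    ofCoord (E := E) p₀ p = mfderiv 𝓘(ℝ, E) 𝓘(ℝ, E) (extChartAt 𝓘(ℝ, E) p₀).symm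
      (extChartAt 𝓘(ℝ, E) p₀ p) := by
  have := TangentBundle.symmL_trivializationAt (I := 𝓘(ℝ, E)) hp
  rwa [ModelWithCorners.range_eq_univ, mfderivWithin_univ] at this

end Coordinates

section FieldsAlong

variable {E : Type*} [NormedAddCommGroup E] [NormedSpace ℝ E]
  {P : Type*} [TopologicalSpace P] [ChartedSpace E P] [IsManifold 𝓘(ℝ, E) ∞ P]
  {F : Type*} [NormedAddCommGroup F] [NormedSpace ℝ F]
  {C : Type*} [TopologicalSpace C] [ChartedSpace F C]
  {g : C → P} {X : ∀ c, TangentSpace 𝓘(ℝ, E) (g c)} {c : C}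

variable (F) in
/-- The vector field `X` along the map `g`, a section of `g^* TP`, is smooth at `c`. -/
def IsSmoothAlongAt (g : C → P) (X : ∀ c, TangentSpace 𝓘(ℝ, E) (g c)) (c : C) : Prop :=
  ContMDiffAt 𝓘(ℝ, F) 𝓘(ℝ, E).tangent ∞ (fun c => (⟨g c, X c⟩ : TangentBundle 𝓘(ℝ, E) P)) c

theorem isSmoothAlongAt_iff_toCoord {p₀ : P} (hg : ContMDiffAt 𝓘(ℝ, F) 𝓘(ℝ, E) ∞ g c)
    (hc : g c ∈ (chartAt E p₀).source) :
    IsSmoothAlongAt F g X c ↔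
      ContMDiffAt 𝓘(ℝ, F) 𝓘(ℝ, E) ∞ (fun c => toCoord p₀ (g c) (X c)) c := by
  let e := trivializationAt E (TangentSpace 𝓘(ℝ, E)) p₀
  rw [IsSmoothAlongAt, e.contMDiffAt_iff
    (f := fun c => (⟨g c, X c⟩ : TangentBundle 𝓘(ℝ, E) P)) (e.mem_source.2 hc)]
  simp only [hg, true_and]
  refine Filter.EventuallyEq.contMDiffAt_iff ?_
  filter_upwards [hg.continuousAt.preimage_mem_nhds ((chartAt E p₀).open_source.mem_nhds hc)]
    with c' hc'
  exact (e.continuousLinearMapAt_apply_of_mem ℝ hc' _).symm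

theorem isSmoothAlongAt_ofCoord {p₀ : P} {v : C → E} (hg : ContMDiffAt 𝓘(ℝ, F) 𝓘(ℝ, E) ∞ g c)
    (hc : g c ∈ (chartAt E p₀).source) (hv : ContMDiffAt 𝓘(ℝ, F) 𝓘(ℝ, E) ∞ v c) :
    IsSmoothAlongAt F g (fun c => ofCoord p₀ (g c) (v c)) c := by
  rw [isSmoothAlongAt_iff_toCoord hg hc]
  refine hv.congr_of_eventuallyEq ?_
  filter_upwards [hg.continuousAt.preimage_mem_nhds ((chartAt E p₀).open_source.mem_nhds hc)]
    with c' hc' using toCoord_ofCoord hc' _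

theorem exists_isSmoothAlong_eq (hg : ContMDiff 𝓘(ℝ, F) 𝓘(ℝ, E) ∞ g) (q : C)
    (V : TangentSpace 𝓘(ℝ, E) (g q)) :
    ∃ X : ∀ c, TangentSpace 𝓘(ℝ, E) (g c), (∀ᶠ c in 𝓝 q, IsSmoothAlongAt F g X c) ∧ X q = V := by
  refine ⟨fun c => ofCoord (g q) (g c) (toCoord (g q) (g q) V), ?_,
    ofCoord_toCoord (mem_chart_source E _) V⟩
  filter_upwards [hg.continuous.continuousAt.eventually (chart_source_mem_nhds E (g q))]
    with c hc using isSmoothAlongAt_ofCoord hg.contMDiffAt hc contMDiffAt_const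

theorem IsSmoothAlongAt.linearMap_apply {G : Type*} [NormedAddCommGroup G] [NormedSpace ℝ G]
    [FiniteDimensional ℝ G] {Λ : ∀ c, G →ₗ[ℝ] TangentSpace 𝓘(ℝ, E) (g c)} {u : C → G}
    (hg : ContMDiffAt 𝓘(ℝ, F) 𝓘(ℝ, E) ∞ g c) (hΛ : ∀ v, IsSmoothAlongAt F g (fun c => Λ c v) c)
    (hu : ContMDiffAt 𝓘(ℝ, F) 𝓘(ℝ, G) ∞ u c) :
    IsSmoothAlongAt F g (fun c => Λ c (u c)) c := by
  have hc := mem_chart_source E (g c)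
  rw [isSmoothAlongAt_iff_toCoord hg hc]
  exact contMDiffAt_linearMap_apply
    (A := fun c' => (toCoord (g c) (g c')).toLinearMap ∘ₗ Λ c')
    (fun v => (isSmoothAlongAt_iff_toCoord hg hc).1 (hΛ v)) hu

theorem IsSmoothAlongAt.smul {ρ : C → ℝ} (hg : ContMDiffAt 𝓘(ℝ, F) 𝓘(ℝ, E) ∞ g c)
    (hρ : ContMDiffAt 𝓘(ℝ, F) 𝓘(ℝ, ℝ) ∞ ρ c) (hX : IsSmoothAlongAt F g X c) :
    IsSmoothAlongAt F g (fun c => ρ c • X c) c := by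
  have hc := mem_chart_source E (g c)
  rw [isSmoothAlongAt_iff_toCoord hg hc] at hX ⊢
  simp only [map_smul]
  exact hρ.smul hX

theorem isSmoothAlongAt_smul_of_tsupport (hg : ContMDiff 𝓘(ℝ, F) 𝓘(ℝ, E) ∞ g)
    {ρ : C → ℝ} (hρ : ContMDiff 𝓘(ℝ, F) 𝓘(ℝ, ℝ) ∞ ρ)
    (hX : ∀ c ∈ tsupport ρ, IsSmoothAlongAt F g X c) (c : C) :
    IsSmoothAlongAt F g (fun c => ρ c • X c) c := by
  by_cases hc : c ∈ tsupport ρ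
  · exact (hX c hc).smul hg.contMDiffAt hρ.contMDiffAt
  · rw [isSmoothAlongAt_iff_toCoord hg.contMDiffAt (mem_chart_source E (g c))]
    refine (contMDiffAt_const (c := (0 : E))).congr_of_eventuallyEq ?_
    filter_upwards [notMem_tsupport_iff_eventuallyEq.1 hc] with c' hc'
    simp [hc']

theorem IsSmoothAlongAt.mfderiv_apply {E' : Type*} [NormedAddCommGroup E'] [NormedSpace ℝ E']
    {Q : Type*} [TopologicalSpace Q] [ChartedSpace E' Q] [IsManifold 𝓘(ℝ, E') ∞ Q]
    {f : P → Q} {U : Set P} (hU : IsOpen U) (hf : ContMDiffOn 𝓘(ℝ, E) 𝓘(ℝ, E') ∞ f U)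
    (hc : g c ∈ U) (hX : IsSmoothAlongAt F g X c) :
    IsSmoothAlongAt F (f ∘ g) (fun c => mfderiv 𝓘(ℝ, E) 𝓘(ℝ, E') f (g c) (X c)) c := by
  have hmem : (⟨g c, X c⟩ : TangentBundle 𝓘(ℝ, E) P) ∈
      Bundle.TotalSpace.proj (E := TangentSpace 𝓘(ℝ, E)) ⁻¹' U := hc
  have hpre : IsOpen (Bundle.TotalSpace.proj (E := (TangentSpace 𝓘(ℝ, E) : P → Type _)) ⁻¹' U) :=
    hU.preimage (FiberBundle.continuous_proj E _)
  have htangent : ContMDiffAt 𝓘(ℝ, E).tangent 𝓘(ℝ, E').tangent ∞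
      (tangentMap 𝓘(ℝ, E) 𝓘(ℝ, E') f) ⟨g c, X c⟩ := by
    refine ((hf.contMDiffOn_tangentMapWithin (m := ∞) le_rfl hU.uniqueMDiffOn).congr
      fun V hV => ?_).contMDiffAt (hpre.mem_nhds hmem)
    exact (tangentMapWithin_eq_tangentMap (hU.uniqueMDiffOn _ hV)
      ((hf.contMDiffAt (hU.mem_nhds hV)).mdifferentiableAt (by simp))).symm
  exact htangent.comp c hX

theorem IsSmoothAlongAt.mvfderiv_apply {f : P → ℝ} (hf : ContMDiff 𝓘(ℝ, E) 𝓘(ℝ, ℝ) ∞ f)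
    (hX : IsSmoothAlongAt F g X c) :
    ContMDiffAt 𝓘(ℝ, F) 𝓘(ℝ, ℝ) ∞ (fun c => mvfderiv 𝓘(ℝ, E) f (g c) (X c)) c :=
  (contMDiff_snd_tangentBundle_modelSpace ℝ 𝓘(ℝ, ℝ)).contMDiffAt.comp c
    (hX.mfderiv_apply isOpen_univ hf.contMDiffOn (mem_univ _))

open Bundle in
theorem contMDiffAt_pullback_tangent_iff (Φ : ContMDiffMap 𝓘(ℝ, F) 𝓘(ℝ, E) C P ∞)
    {X : ∀ c, TangentSpace 𝓘(ℝ, E) (Φ c)} :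
    ContMDiffAt 𝓘(ℝ, F) (𝓘(ℝ, F).prod 𝓘(ℝ, E)) ∞
      (fun c => TotalSpace.mk' (E := Φ *ᵖ (TangentSpace 𝓘(ℝ, E) : P → Type _)) E c (X c)) c ↔
    IsSmoothAlongAt F Φ X c := by
  refine (contMDiffAt_section (IB := 𝓘(ℝ, F)) (F := E)
    (E := Φ *ᵖ (TangentSpace 𝓘(ℝ, E) : P → Type _)) (s := X) c).trans ?_
  refine Iff.trans ?_ (contMDiffAt_totalSpace (IM := 𝓘(ℝ, F)) (IB := 𝓘(ℝ, E)) (F := E)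
    (E := (TangentSpace 𝓘(ℝ, E) : P → Type _)) (f := fun c => ⟨Φ c, X c⟩) (x₀ := c)).symm
  exact ⟨fun h => ⟨Φ.contMDiff.contMDiffAt, h⟩, fun h => h.2⟩

variable [IsManifold 𝓘(ℝ, F) ∞ C]

theorem exists_pushField_eq {ι : C → P} (hι : IsSmoothEmbedding 𝓘(ℝ, F) 𝓘(ℝ, E) ∞ ι)
    {X : ∀ c, TangentSpace 𝓘(ℝ, E) (ι c)} (hX : ∀ c, IsSmoothAlongAt F ι X c)
    (hX_tangent : ∀ c, X c ∈ subTangent (F := F) ι c) :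
    ∃ Y : ∀ c, TangentSpace 𝓘(ℝ, F) c, IsSmoothField Y ∧ pushField ι Y = X := by
  choose Y hY using hX_tangent
  refine ⟨Y, fun q => ?_, funext hY⟩
  obtain ⟨U, r, hU, hqU, hr, hrι⟩ := exists_local_retraction hι q
  have hι_mem : ∀ᶠ c in 𝓝 q, ι c ∈ U :=
    hι.contMDiff.continuous.continuousAt.eventually (hU.mem_nhds hqU)
  refine ((hX q).mfderiv_apply hU hr hqU).congr_of_eventuallyEq ?_
  filter_upwards [hι_mem.eventually_nhds] with c hc
  have hcU := hc.self_of_nhds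
  have hrY : (mfderiv 𝓘(ℝ, E) 𝓘(ℝ, F) r (ι c) (X c) : F) = Y c := by
    rw [← hY]
    exact mfderiv_mfderiv_of_eventually_leftInverse
      ((hr.contMDiffAt (hU.mem_nhds hcU)).mdifferentiableAt (by simp))
      (hι.contMDiff.mdifferentiableAt (by simp)) (hc.mono hrι) (Y c)
  exact Bundle.TotalSpace.ext (hrι c hcU).symm (heq_of_eq hrY.symm)

theorem exists_isSmoothAlong_forall_mem_convex [FiniteDimensional ℝ F] [T2Space C]
    [SigmaCompactSpace C] (hg : ContMDiff 𝓘(ℝ, F) 𝓘(ℝ, E) ∞ g)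
    (t : ∀ c, Set (TangentSpace 𝓘(ℝ, E) (g c))) (ht : ∀ c, Convex ℝ (t c))
    (hlocal : ∀ q, ∃ X : ∀ c, TangentSpace 𝓘(ℝ, E) (g c),
      ∀ᶠ c in 𝓝 q, IsSmoothAlongAt F g X c ∧ X c ∈ t c) :
    ∃ X : ∀ c, TangentSpace 𝓘(ℝ, E) (g c), ∀ c, IsSmoothAlongAt F g X c ∧ X c ∈ t c := by
  let Φ : ContMDiffMap 𝓘(ℝ, F) 𝓘(ℝ, E) C P ∞ := ⟨g, hg⟩
  let (c : C) : AddCommGroup (Bundle.Pullback Φ (TangentSpace 𝓘(ℝ, E) : P → Type _) c) :=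
    inferInstanceAs (AddCommGroup (TangentSpace 𝓘(ℝ, E) (Φ c)))
  obtain ⟨s, hs⟩ := exists_contMDiffSection_forall_mem_convex_of_local (n := ⊤) 𝓘(ℝ, F)
    (F_fiber := E) (Bundle.Pullback Φ (TangentSpace 𝓘(ℝ, E) : P → Type _)) t ht fun q => by
      obtain ⟨X, hX⟩ := hlocal q
      exact ⟨_, hX, X, fun c hc =>
        ((contMDiffAt_pullback_tangent_iff Φ).2 hc.1).contMDiffWithinAt, fun c hc => hc.2⟩
  exact ⟨s, fun c => ⟨(contMDiffAt_pullback_tangent_iff Φ).1 s.contMDiff.contMDiffAt, hs c⟩⟩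

end FieldsAlong

section BilinearAlgebra

variable {K V G G' : Type*} [Field K] [AddCommGroup V] [Module K V]
  [AddCommGroup G] [Module K G] [AddCommGroup G'] [Module K G']

theorem finrank_comap_of_injective {Λ : G →ₗ[K] V} (hΛ : Function.Injective Λ)
    (D : Submodule K V) :
    Module.finrank K (D.comap Λ) = Module.finrank K (LinearMap.range Λ ⊓ D : Submodule K V) := by
  rw [← Submodule.map_comap_eq]
  exact (Submodule.equivMapOfInjective Λ hΛ _).finrank_eq

variable [FiniteDimensional K V]

theorem exists_mem_apply_eq_iff_orthogonal (B : LinearMap.BilinForm K V) (W : Submodule K V)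
    (φ : Module.Dual K V) : (∃ v ∈ W, B v = φ) ↔ ∀ w ∈ B.orthogonal W, φ w = 0 := by
  rw [← LinearMap.BilinForm.toLin_restrict_range_dualCoannihilator_eq_orthogonal,
    ← Submodule.mem_dualAnnihilator, Subspace.dualCoannihilator_dualAnnihilator_eq]
  simp

theorem finrank_range_compl₁₂_add_finrank_orthogonal (B : LinearMap.BilinForm K V)
    (Λ : G →ₗ[K] V) {Λ' : G' →ₗ[K] V} (hΛ' : Function.Surjective Λ') :
    Module.finrank K (LinearMap.range (B.compl₁₂ Λ Λ')) +
      Module.finrank K (B.orthogonal (LinearMap.range Λ)) = Module.finrank K V := by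
  let S := LinearMap.range (B.domRestrict (LinearMap.range Λ))
  have hrange : LinearMap.range (B.compl₁₂ Λ Λ') = S.map Λ'.dualMap := by
    ext φ
    simp only [S, LinearMap.mem_range, Submodule.mem_map, Subtype.exists]
    constructor
    · rintro ⟨u, rfl⟩
      exact ⟨_, ⟨Λ u, ⟨u, rfl⟩, rfl⟩, rfl⟩
    · rintro ⟨_, ⟨_, ⟨u, rfl⟩, rfl⟩, rfl⟩
      exact ⟨u, rfl⟩
  have hinj := LinearMap.dualMap_injective_of_surjective hΛ'
  rw [hrange, ← (Submodule.equivMapOfInjective _ hinj S).finrank_eq,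
    ← LinearMap.BilinForm.toLin_restrict_range_dualCoannihilator_eq_orthogonal]
  exact Subspace.finrank_add_finrank_dualCoannihilator_eq S

end BilinearAlgebra

section Alternating

variable {V : Type*} [AddCommGroup V] [Module ℝ V] [TopologicalSpace V]

theorem alternating_swap (θ : V [⋀^Fin 2]→L[ℝ] ℝ) (v w : V) : θ ![v, w] = -θ ![w, v] := by
  refine Eq.trans (congrArg θ (funext fun i => ?_))
    (θ.toAlternatingMap.map_swap ![w, v] (i := 0) (j := 1) (by simp))
  fin_cases i <;> rfl

/-- A 2-form on a vector space as a bilinear form. -/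
def alternatingBilin (θ : V [⋀^Fin 2]→L[ℝ] ℝ) : LinearMap.BilinForm ℝ V :=
  LinearMap.mk₂ ℝ (fun v w => θ ![v, w]) (fun v v' w => θ.vecCons_add ![w] v v')
    (fun a v w => θ.vecCons_smul ![w] a v)
    (fun v w w' => by
      rw [alternating_swap, θ.vecCons_add, neg_add, ← alternating_swap, ← alternating_swap])
    (fun a v w => by rw [alternating_swap, θ.vecCons_smul, ← smul_neg, ← alternating_swap])

end Alternating

section TwoForm

variable {E : Type*} [NormedAddCommGroup E] [NormedSpace ℝ E]
  {P : Type*} [TopologicalSpace P] [ChartedSpace E P]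
  (η : TwoForm E P)

/-- Smoothness of a 2-form, expressed in the charts of the manifold. -/
def TwoForm.IsSmooth : Prop :=
  ∀ x : P, ContDiffOn ℝ ∞ (η.inChart x) (extChartAt 𝓘(ℝ, E) x).target

theorem TwoForm.inChart_apply {p₀ p : P} {y : E} (hy : (extChartAt 𝓘(ℝ, E) p₀).symm y = p)
    (v w : E) :
    η.inChart p₀ y ![v, w] = η p ![mfderiv 𝓘(ℝ, E) 𝓘(ℝ, E) (extChartAt 𝓘(ℝ, E) p₀).symm y v,
      mfderiv 𝓘(ℝ, E) 𝓘(ℝ, E) (extChartAt 𝓘(ℝ, E) p₀).symm y w] := by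
  subst hy
  refine congrArg (η ((extChartAt 𝓘(ℝ, E) p₀).symm y)) (funext fun i => ?_)
  fin_cases i <;> rfl

variable {η} [IsManifold 𝓘(ℝ, E) ∞ P]

theorem TwoForm.inChart_toCoord {p₀ p : P} (hp : p ∈ (chartAt E p₀).source)
    (V W : TangentSpace 𝓘(ℝ, E) p) :
    η.inChart p₀ (extChartAt 𝓘(ℝ, E) p₀ p) ![toCoord p₀ p V, toCoord p₀ p W] = η p ![V, W] := by
  have hp_inv : (extChartAt 𝓘(ℝ, E) p₀).symm (extChartAt 𝓘(ℝ, E) p₀ p) = p :=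
    (extChartAt 𝓘(ℝ, E) p₀).left_inv (by rwa [extChartAt_source])
  have hofCoord := ofCoord_eq_mfderiv hp
  calc _ = η p ![ofCoord p₀ p (toCoord p₀ p V), ofCoord p₀ p (toCoord p₀ p W)] := by
        rw [TwoForm.inChart_apply η hp_inv, hofCoord]
        rfl
    _ = η p ![V, W] := by rw [ofCoord_toCoord hp, ofCoord_toCoord hp]

variable {F : Type*} [NormedAddCommGroup F] [NormedSpace ℝ F]
  {C : Type*} [TopologicalSpace C] [ChartedSpace F C] {g : C → P}
  {X Y : ∀ c, TangentSpace 𝓘(ℝ, E) (g c)} {c : C}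

theorem TwoForm.IsSmooth.contMDiffAt_apply [FiniteDimensional ℝ E] (hη : η.IsSmooth)
    (hg : ContMDiffAt 𝓘(ℝ, F) 𝓘(ℝ, E) ∞ g c) (hX : IsSmoothAlongAt F g X c)
    (hY : IsSmoothAlongAt F g Y c) :
    ContMDiffAt 𝓘(ℝ, F) 𝓘(ℝ, ℝ) ∞ (fun c => η (g c) ![X c, Y c]) c := by
  have hc := mem_chart_source E (g c)
  rw [isSmoothAlongAt_iff_toCoord hg hc] at hX hY
  let θ (c' : C) := η.inChart (g c) (extChartAt 𝓘(ℝ, E) (g c) (g c'))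
  have hθ : ContMDiffAt 𝓘(ℝ, F) 𝓘(ℝ, E [⋀^Fin 2]→L[ℝ] ℝ) ∞ θ c :=
    (((hη (g c)).contDiffAt (extChartAt_target_mem_nhds (g c))).contMDiffAt.comp (g c)
      contMDiffAt_extChartAt).comp c hg
  have hθ_apply (u v : E) : ContMDiffAt 𝓘(ℝ, F) 𝓘(ℝ, ℝ) ∞ (fun c => θ c ![u, v]) c :=
    (ContinuousAlternatingMap.apply ℝ E ℝ ![u, v]).contMDiff.contMDiffAt.comp c hθ
  refine (contMDiffAt_linearMap_apply (A := fun c' =>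
    (alternatingBilin (θ c')).flip (toCoord (g c) (g c') (Y c')))
    (fun u => contMDiffAt_linearMap_apply (A := fun c => alternatingBilin (θ c) u)
      (hθ_apply u) hY) hX).congr_of_eventuallyEq ?_
  filter_upwards [hg.continuousAt.eventually (chart_source_mem_nhds E (g c))] with c' hc'
    using (TwoForm.inChart_toCoord hc' _ _).symm

end TwoForm

section HamiltonianVectors

variable {E : Type*} [NormedAddCommGroup E] [NormedSpace ℝ E]
  {P : Type*} [TopologicalSpace P] [ChartedSpace E P]
  {F : Type*} [NormedAddCommGroup F] [NormedSpace ℝ F]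
  {C : Type*} [TopologicalSpace C] [ChartedSpace F C]
  {η : TwoForm E P} {ι : C → P} {f : P → ℝ} {p : P} {W : Submodule ℝ (TangentSpace 𝓘(ℝ, E) p)}

/-- The polar `W^⊥` of a subspace with respect to an arbitrary 2-form. -/
def TwoForm.polar (η : TwoForm E P) {p : P} (W : Submodule ℝ (TangentSpace 𝓘(ℝ, E) p)) :
    Submodule ℝ (TangentSpace 𝓘(ℝ, E) p) :=
  (alternatingBilin (η p)).orthogonal W

theorem TwoForm.mem_polar {V : TangentSpace 𝓘(ℝ, E) p} :
    V ∈ η.polar W ↔ ∀ W' ∈ W, η p ![V, W'] = 0 :=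
  forall₂_congr fun W' _ => by
    rw [alternating_swap, neg_eq_zero]
    rfl

/-- The equation `i_V η = d f` at the point `p`, for an arbitrary 2-form `η`. -/
def TwoForm.IsHamiltonianVector (η : TwoForm E P) (f : P → ℝ) {p : P}
    (V : TangentSpace 𝓘(ℝ, E) p) : Prop :=
  ∀ W : TangentSpace 𝓘(ℝ, E) p, η p ![V, W] = mvfderiv 𝓘(ℝ, E) f p W

theorem TwoForm.exists_isHamiltonianVector_mem_iff [FiniteDimensional ℝ E] :
    (∃ V ∈ W, η.IsHamiltonianVector f V) ↔ DerivVanishesOn f (η.polar W) := by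
  have : FiniteDimensional ℝ (TangentSpace 𝓘(ℝ, E) p) := inferInstanceAs (FiniteDimensional ℝ E)
  have h := exists_mem_apply_eq_iff_orthogonal (alternatingBilin (η p)) W
    (mvfderiv 𝓘(ℝ, E) f p).toLinearMap
  simp only [LinearMap.ext_iff] at h
  exact h

theorem TwoForm.exists_isHamiltonianVector_iff [FiniteDimensional ℝ E] :
    (∃ V : TangentSpace 𝓘(ℝ, E) p, η.IsHamiltonianVector f V) ↔
      DerivVanishesOn f (η.polar (p := p) ⊤) := by
  simp only [← TwoForm.exists_isHamiltonianVector_mem_iff, Submodule.mem_top, true_and]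

theorem TwoForm.convex_setOf_mem_isHamiltonianVector :
    Convex ℝ {V | V ∈ W ∧ η.IsHamiltonianVector f V} := by
  have hconvex : Convex ℝ (alternatingBilin (η p) ⁻¹' {(mvfderiv 𝓘(ℝ, E) f p).toLinearMap}) :=
    (convex_singleton _).linear_preimage _
  convert W.convex.inter hconvex using 1
  exact Set.ext fun V => and_congr_right fun _ =>
    (LinearMap.ext_iff (f := alternatingBilin (η p) V)).symm

theorem IsConstraint.derivVanishesOn_subTangent (hf : IsConstraint E ι f)
    (hι : ContMDiff 𝓘(ℝ, F) 𝓘(ℝ, E) ∞ ι) (q : C) :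
    DerivVanishesOn f (subTangent (E := E) (F := F) ι q) := by
  rintro _ ⟨v, rfl⟩
  calc _ = mvfderiv 𝓘(ℝ, F) (f ∘ ι) q v :=
        (mvfderiv_comp_apply q (hf.smooth.mdifferentiableAt (by simp))
          (hι.mdifferentiableAt (by simp)) v).symm
    _ = 0 := by
        rw [show f ∘ ι = fun _ => 0 from funext hf.vanishes, mvfderiv_const]
        rfl

theorem TwoForm.IsHamiltonianVector.mem_polar_subTangent {q : C}
    {V : TangentSpace 𝓘(ℝ, E) (ι q)} (hV : η.IsHamiltonianVector f V)
    (hf : IsConstraint E ι f) (hι : ContMDiff 𝓘(ℝ, F) 𝓘(ℝ, E) ∞ ι) :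
    V ∈ η.polar (subTangent (F := F) ι q) :=
  TwoForm.mem_polar.2 fun W hW => (hV W).trans (hf.derivVanishesOn_subTangent hι q W hW)

end HamiltonianVectors

section Constraints

theorem mvfderiv_clm_apply_of_eq_zero {𝕜 E B P H G : Type*} [NontriviallyNormedField 𝕜]
    [NormedAddCommGroup E] [NormedSpace 𝕜 E] [TopologicalSpace B] {I : ModelWithCorners 𝕜 E B}
    [TopologicalSpace P] [ChartedSpace B P] [NormedAddCommGroup H] [NormedSpace 𝕜 H]
    [NormedAddCommGroup G] [NormedSpace 𝕜 G] {A : P → H →L[𝕜] G} {h : P → H} {p : P}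
    (hA : MDifferentiableAt I 𝓘(𝕜, H →L[𝕜] G) A p) (hh : MDifferentiableAt I 𝓘(𝕜, H) h p)
    (hp : h p = 0) (W : TangentSpace I p) :
    mvfderiv I (fun p => A p (h p)) p W = A p (mvfderiv I h p W) := by
  have hderiv : HasMFDerivAt I 𝓘(𝕜, G) (fun p => A p (h p)) p _ :=
    ⟨hA.continuousAt.clm_apply hh.continuousAt, hA.hasMFDerivAt.2.clm_apply hh.hasMFDerivAt.2⟩
  refine (congrArg (fun L : E →L[𝕜] G => L W) hderiv.mfderiv).trans ?_
  change A ((extChartAt I p).symm (extChartAt I p p)) (mfderiv I 𝓘(𝕜, H) h p W) +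
    (show E →L[𝕜] H →L[𝕜] G from mfderiv I 𝓘(𝕜, H →L[𝕜] G) A p) W
      (h ((extChartAt I p).symm (extChartAt I p p))) = _
  rw [extChartAt_to_inv, hp, map_zero, add_zero]
  rfl

variable {E : Type*} [NormedAddCommGroup E] [NormedSpace ℝ E]
  {P : Type*} [TopologicalSpace P] [ChartedSpace E P] [IsManifold 𝓘(ℝ, E) ∞ P]

theorem exists_isConstraint_mvfderiv_eq_smul {C : Type*} {ι : C → P} [FiniteDimensional ℝ E]
    [T2Space P] {U : Set P} {g : P → ℝ} {p₀ : P} (hU : IsOpen U) (hp₀ : p₀ ∈ U)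
    (hg : ContMDiffOn 𝓘(ℝ, E) 𝓘(ℝ, ℝ) ∞ g U) (hgι : ∀ c, ι c ∈ U → g (ι c) = 0) :
    ∃ f ρ : P → ℝ, IsConstraint E ι f ∧ ContMDiff 𝓘(ℝ, E) 𝓘(ℝ, ℝ) ∞ ρ ∧ ρ p₀ = 1 ∧
      tsupport ρ ⊆ U ∧
      ∀ c, mvfderiv 𝓘(ℝ, E) f (ι c) = ρ (ι c) • mvfderiv 𝓘(ℝ, E) g (ι c) := by
  obtain ⟨ρ, -, hρU⟩ := (SmoothBumpFunction.nhds_basis_tsupport (I := 𝓘(ℝ, E))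
    p₀).mem_iff.1 (hU.mem_nhds hp₀)
  have hgU (p) (hp : p ∈ U) : ContMDiffAt 𝓘(ℝ, E) 𝓘(ℝ, ℝ) ∞ g p :=
    hg.contMDiffAt (hU.mem_nhds hp)
  have hzero (p) (hp : p ∉ U) : ρ =ᶠ[𝓝 p] 0 :=
    notMem_tsupport_iff_eventuallyEq.1 fun h => hp (hρU h)
  refine ⟨fun p => ρ p • g p, ρ, ⟨contMDiff_of_tsupport fun p hp => ?_, fun c => ?_⟩,
    ρ.contMDiff, ρ.eq_one, hρU, fun c => ?_⟩
  · exact ρ.contMDiffAt.smul (hgU p (hρU (tsupport_smul_subset_left _ _ hp)))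
  · by_cases hc : ι c ∈ U
    · simp [hgι c hc]
    · simp [(hzero _ hc).self_of_nhds]
  by_cases hc : ι c ∈ U
  · rw [mvfderiv_fun_smul (ρ.contMDiffAt.mdifferentiableAt (by simp))
      ((hgU _ hc).mdifferentiableAt (by simp)), hgι c hc]
    exact (congrArg (ρ (ι c) • mvfderiv 𝓘(ℝ, E) g (ι c) + ·)
      (ContinuousLinearMap.ext fun W => mul_zero _)).trans (add_zero _)
  · have hf : (fun p => ρ p • g p) =ᶠ[𝓝 (ι c)] 0 := by
      filter_upwards [hzero _ hc] with p hp
      simp [hp]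
    rw [(hzero _ hc).self_of_nhds, Pi.zero_apply, zero_smul]
    exact hf.mfderiv_eq.trans (mvfderiv_zero (I := 𝓘(ℝ, E)) (F := ℝ))

variable {F : Type*} [NormedAddCommGroup F] [NormedSpace ℝ F]
  {C : Type*} [TopologicalSpace C] [ChartedSpace F C]
  {ι : C → P}

theorem mvfderiv_extChartAt_sub_comp {r : P → P} {p₀ p : P}
    (hr : MDifferentiableAt 𝓘(ℝ, E) 𝓘(ℝ, E) r p) (hp : p ∈ (chartAt E p₀).source)
    (hrp : r p = p) (W : TangentSpace 𝓘(ℝ, E) p) :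
    mvfderiv 𝓘(ℝ, E) (fun p => extChartAt 𝓘(ℝ, E) p₀ p - extChartAt 𝓘(ℝ, E) p₀ (r p)) p W =
      toCoord p₀ p W - toCoord p₀ p (mfderiv 𝓘(ℝ, E) 𝓘(ℝ, E) r p W : E) := by
  have hχ : MDifferentiableAt 𝓘(ℝ, E) 𝓘(ℝ, E) (extChartAt 𝓘(ℝ, E) p₀) p :=
    mdifferentiableAt_extChartAt hp
  have hχr : MDifferentiableAt 𝓘(ℝ, E) 𝓘(ℝ, E) (extChartAt 𝓘(ℝ, E) p₀ ∘ r) p :=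
    (hrp.symm ▸ hχ : MDifferentiableAt 𝓘(ℝ, E) 𝓘(ℝ, E) _ (r p)).comp p hr
  rw [toCoord_eq_mfderiv hp]
  refine (congrArg (fun L : E →L[ℝ] E => L W) (mvfderiv_sub hχ hχr)).trans ?_
  exact congrArg (fun V : E => (mvfderiv 𝓘(ℝ, E) (extChartAt 𝓘(ℝ, E) p₀) p W : E) - V)
    (mfderiv_comp_apply_of_eq p hχ hr hrp W)

theorem mvfderiv_clm_apply_extChartAt_sub_retraction {A : C → E →L[ℝ] ℝ} {r : P → C} {p₀ : P}
    {c : C} (hA : MDifferentiableAt 𝓘(ℝ, F) 𝓘(ℝ, E →L[ℝ] ℝ) A c)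
    (hι : MDifferentiableAt 𝓘(ℝ, F) 𝓘(ℝ, E) ι c)
    (hr : MDifferentiableAt 𝓘(ℝ, E) 𝓘(ℝ, F) r (ι c)) (hrc : r (ι c) = c)
    (hc : ι c ∈ (chartAt E p₀).source)
    (hT : ∀ W ∈ subTangent (F := F) ι c, A c (toCoord p₀ (ι c) W) = 0)
    (W : TangentSpace 𝓘(ℝ, E) (ι c)) :
    mvfderiv 𝓘(ℝ, E)
      (fun p => A (r p) (extChartAt 𝓘(ℝ, E) p₀ p - extChartAt 𝓘(ℝ, E) p₀ (ι (r p)))) (ι c) W =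
      A c (toCoord p₀ (ι c) W) := by
  let χ := extChartAt 𝓘(ℝ, E) p₀
  have hχ : MDifferentiableAt 𝓘(ℝ, E) 𝓘(ℝ, E) χ (ι c) := mdifferentiableAt_extChartAt hc
  have hιr : MDifferentiableAt 𝓘(ℝ, E) 𝓘(ℝ, E) (ι ∘ r) (ι c) :=
    hι.comp_of_eq (ι c) hr hrc
  have hh : MDifferentiableAt 𝓘(ℝ, E) 𝓘(ℝ, E) (fun p => χ p - χ ((ι ∘ r) p)) (ι c) :=
    hχ.sub (hχ.comp_of_eq (ι c) hιr (congrArg ι hrc))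
  have hAr : MDifferentiableAt 𝓘(ℝ, E) 𝓘(ℝ, E →L[ℝ] ℝ) (A ∘ r) (ι c) := hA.comp_of_eq (ι c) hr hrc
  let v : TangentSpace 𝓘(ℝ, F) c := (mfderiv 𝓘(ℝ, E) 𝓘(ℝ, F) r (ι c) W : F)
  have hv : (mfderiv 𝓘(ℝ, E) 𝓘(ℝ, E) (ι ∘ r) (ι c) W : E) = mfderiv 𝓘(ℝ, F) 𝓘(ℝ, E) ι c v :=
    mfderiv_comp_apply_of_eq (ι c) hι hr hrc W
  calc _ = A (r (ι c)) (mvfderiv 𝓘(ℝ, E) (fun p => χ p - χ ((ι ∘ r) p)) (ι c) W) :=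
        mvfderiv_clm_apply_of_eq_zero hAr hh (by rw [Function.comp_apply, hrc, sub_self]) W
    _ = A c (toCoord p₀ (ι c) W) - A c (toCoord p₀ (ι c) (mfderiv 𝓘(ℝ, F) 𝓘(ℝ, E) ι c v)) := by
        rw [hrc, mvfderiv_extChartAt_sub_comp hιr hc (congrArg ι hrc) W, hv, map_sub]
    _ = A c (toCoord p₀ (ι c) W) := by
        rw [hT (mfderiv 𝓘(ℝ, F) 𝓘(ℝ, E) ι c v) ⟨v, rfl⟩, sub_zero]

/-- With a local retraction `r` onto the submanifold and a chart `χ`, the constraint is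
`p ↦ α (r p) (χ p - χ (ι (r p)))`. -/
theorem exists_local_constraint [FiniteDimensional ℝ E]
    (hι : IsSmoothEmbedding 𝓘(ℝ, F) 𝓘(ℝ, E) ∞ ι) (q : C)
    {α : ∀ c, TangentSpace 𝓘(ℝ, E) (ι c) →ₗ[ℝ] ℝ}
    (hα : ∀ᶠ c in 𝓝 q, ∀ v, ContMDiffAt 𝓘(ℝ, F) 𝓘(ℝ, ℝ) ∞
      (fun c => α c (ofCoord (ι q) (ι c) v)) c) :
    ∃ (U : Set P) (g : P → ℝ), IsOpen U ∧ ι q ∈ U ∧ ContMDiffOn 𝓘(ℝ, E) 𝓘(ℝ, ℝ) ∞ g U ∧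
      ∀ c, ι c ∈ U → g (ι c) = 0 ∧ ((∀ W ∈ subTangent (F := F) ι c, α c W = 0) →
        ∀ W, mvfderiv 𝓘(ℝ, E) g (ι c) W = α c W) := by
  obtain ⟨U, r, hU, hqU, hr, hrι⟩ := exists_local_retraction hι q
  obtain ⟨N, hN, hN_open, hqN⟩ := eventually_nhds_iff.1 hα
  let S := (chartAt E (ι q)).source
  have hS : IsOpen S := (chartAt E (ι q)).open_source
  let χ := extChartAt 𝓘(ℝ, E) (ι q)
  let A (c : C) : E →L[ℝ] ℝ :=
    LinearMap.toContinuousLinearMap (α c ∘ₗ (ofCoord (ι q) (ι c)).toLinearMap)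
  have hA_toCoord (c : C) (hc : ι c ∈ S) (W) : A c (toCoord (ι q) (ι c) W) = α c W :=
    congrArg (α c) (ofCoord_toCoord hc W)
  let U' := S ∩ (U ∩ r ⁻¹' (N ∩ ι ⁻¹' S))
  have hU' : IsOpen U' := hS.inter (hr.continuousOn.isOpen_inter_preimage hU
    (hN_open.inter (hS.preimage hι.contMDiff.continuous)))
  have hr' (p) (hp : p ∈ U') : ContMDiffAt 𝓘(ℝ, E) 𝓘(ℝ, F) ∞ r p :=
    hr.contMDiffAt (hU.mem_nhds hp.2.1)
  have hA (p) (hp : p ∈ U') : ContMDiffAt 𝓘(ℝ, E) 𝓘(ℝ, E →L[ℝ] ℝ) ∞ (A ∘ r) p :=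
    (contMDiffAt_clm_of_apply (hN _ hp.2.2.1)).comp p (hr' p hp)
  have hh (p) (hp : p ∈ U') : ContMDiffAt 𝓘(ℝ, E) 𝓘(ℝ, E) ∞ (fun p => χ p - χ (ι (r p))) p :=
    (contMDiffAt_extChartAt' hp.1).sub ((contMDiffAt_extChartAt' hp.2.2.2).comp p
      (hι.contMDiff.contMDiffAt.comp p (hr' p hp)))
  refine ⟨U', fun p => A (r p) (χ p - χ (ι (r p))), hU', ⟨mem_chart_source E _, hqU, ?_⟩,
    fun p hp => ((hA p hp).clm_apply (hh p hp)).contMDiffWithinAt, fun c hc => ⟨?_, fun hT => ?_⟩⟩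
  · simpa [hrι q hqU] using ⟨hqN, mem_chart_source E (ι q)⟩
  · simp [hrι c hc.2.1]
  · have hrc : r (ι c) = c := hrι c hc.2.1
    have hAc := (contMDiffAt_clm_of_apply (A := A)
      (hN _ (hrc ▸ hc.2.2.1))).mdifferentiableAt (by simp)
    exact fun W => (mvfderiv_clm_apply_extChartAt_sub_retraction hAc
      (hι.contMDiff.mdifferentiableAt (by simp)) ((hr' _ hc).mdifferentiableAt (by simp)) hrc hc.1
      (fun V hV => (hA_toCoord c hc.1 V).trans (hT V hV)) W).trans (hA_toCoord c hc.1 W)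

end Constraints

section Frames

variable {E : Type*} [NormedAddCommGroup E] [NormedSpace ℝ E]
  {P : Type*} [TopologicalSpace P] [ChartedSpace E P] [IsManifold 𝓘(ℝ, E) ∞ P]
  {F : Type*} [NormedAddCommGroup F] [NormedSpace ℝ F]
  {C : Type*} [TopologicalSpace C] [ChartedSpace F C]

variable (F) in
/-- Near `q`, the maps `Λ c` form a smooth frame of the family `W` of subspaces along `g`,
parametrized by the vector space `G`. -/
structure IsFrameNear (g : C → P) {G : Type*} [AddCommGroup G] [Module ℝ G]
    (Λ : ∀ c, G →ₗ[ℝ] TangentSpace 𝓘(ℝ, E) (g c))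
    (W : ∀ c, Submodule ℝ (TangentSpace 𝓘(ℝ, E) (g c))) (q : C) : Prop where
  smooth : ∀ᶠ c in 𝓝 q, ∀ u, IsSmoothAlongAt F g (fun c => Λ c u) c
  injective : ∀ᶠ c in 𝓝 q, Function.Injective (Λ c)
  range_eq : ∀ᶠ c in 𝓝 q, LinearMap.range (Λ c) = W c

theorem isFrameNear_ofCoord {g : C → P} (hg : ContMDiff 𝓘(ℝ, F) 𝓘(ℝ, E) ∞ g) (q : C) :
    IsFrameNear F g (fun c => (ofCoord (E := E) (g q) (g c)).toLinearMap) (fun _ => ⊤) q := by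
  have hq := hg.continuous.continuousAt.eventually (chart_source_mem_nhds E (g q))
  exact ⟨hq.mono fun c hc v => isSmoothAlongAt_ofCoord hg.contMDiffAt hc contMDiffAt_const,
    hq.mono fun c hc => Function.LeftInverse.injective (toCoord_ofCoord hc),
    hq.mono fun c hc => LinearMap.range_eq_top.2
      (Function.RightInverse.surjective (ofCoord_toCoord hc))⟩

theorem isFrameNear_subTangent [IsManifold 𝓘(ℝ, F) ∞ C] {ι : C → P}
    (hι : IsSmoothEmbedding 𝓘(ℝ, F) 𝓘(ℝ, E) ∞ ι) (q : C) :
    IsFrameNear F ι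
      (fun c => (mfderiv 𝓘(ℝ, F) 𝓘(ℝ, E) ι c).toLinearMap ∘ₗ (ofCoord (E := F) q c).toLinearMap)
      (subTangent (F := F) ι) q := by
  have hq := isFrameNear_ofCoord (F := F) (g := id) contMDiff_id q
  exact ⟨hq.smooth.mono fun c hc v =>
      (hc v).mfderiv_apply isOpen_univ hι.contMDiff.contMDiffOn (mem_univ _),
    hq.injective.mono fun c hc => (mfderiv_injective_of_isSmoothEmbedding hι (by simp) c).comp hc,
    hq.range_eq.mono fun c hc => LinearMap.range_comp_of_range_eq_top _ hc⟩

end Frames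

section Pairing

variable {E : Type*} [NormedAddCommGroup E] [NormedSpace ℝ E]
  {P : Type*} [TopologicalSpace P] [ChartedSpace E P]
  {F : Type*} [NormedAddCommGroup F] [NormedSpace ℝ F]
  {C : Type*} [TopologicalSpace C] [ChartedSpace F C]
  {G : Type*} [NormedAddCommGroup G] [NormedSpace ℝ G]
  {G' : Type*} [NormedAddCommGroup G'] [NormedSpace ℝ G'] [FiniteDimensional ℝ G']
  {p : P} {η : TwoForm E P}

/-- The matrix of a 2-form with respect to two frames. -/
def TwoForm.pairing (η : TwoForm E P) (Λ : G →ₗ[ℝ] TangentSpace 𝓘(ℝ, E) p)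
    (Λ' : G' →ₗ[ℝ] TangentSpace 𝓘(ℝ, E) p) : G →ₗ[ℝ] G' →L[ℝ] ℝ :=
  LinearMap.toContinuousLinearMap.toLinearMap ∘ₗ (alternatingBilin (η p)).compl₁₂ Λ Λ'

theorem TwoForm.pairing_apply {Λ : G →ₗ[ℝ] TangentSpace 𝓘(ℝ, E) p}
    {Λ' : G' →ₗ[ℝ] TangentSpace 𝓘(ℝ, E) p} (u : G) (v : G') :
    η.pairing Λ Λ' u v = η p ![Λ u, Λ' v] :=
  rfl

theorem TwoForm.ker_pairing (Λ : G →ₗ[ℝ] TangentSpace 𝓘(ℝ, E) p)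
    (Λ' : G' →ₗ[ℝ] TangentSpace 𝓘(ℝ, E) p) :
    LinearMap.ker (η.pairing Λ Λ') = (η.polar (LinearMap.range Λ')).comap Λ := by
  ext u
  simp only [LinearMap.mem_ker, ContinuousLinearMap.ext_iff, TwoForm.pairing_apply,
    Submodule.mem_comap, TwoForm.mem_polar, LinearMap.mem_range, forall_exists_index,
    forall_apply_eq_imp_iff, zero_apply]

theorem TwoForm.finrank_range_pairing_add_finrank_polar [FiniteDimensional ℝ E]
    (Λ : G →ₗ[ℝ] TangentSpace 𝓘(ℝ, E) p) {Λ' : G' →ₗ[ℝ] TangentSpace 𝓘(ℝ, E) p}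
    (hΛ' : Function.Surjective Λ') :
    Module.finrank ℝ (LinearMap.range (η.pairing Λ Λ')) +
      Module.finrank ℝ (η.polar (LinearMap.range Λ)) = Module.finrank ℝ E := by
  have : FiniteDimensional ℝ (TangentSpace 𝓘(ℝ, E) p) := inferInstanceAs (FiniteDimensional ℝ E)
  rw [TwoForm.pairing, LinearMap.range_comp, LinearEquiv.finrank_map_eq]
  exact finrank_range_compl₁₂_add_finrank_orthogonal (alternatingBilin (η p)) Λ hΛ'

variable [FiniteDimensional ℝ E] [IsManifold 𝓘(ℝ, E) ∞ P] {g : C → P}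
  {W W' : ∀ c, Submodule ℝ (TangentSpace 𝓘(ℝ, E) (g c))}
  {Λ : ∀ c, G →ₗ[ℝ] TangentSpace 𝓘(ℝ, E) (g c)} {Λ' : ∀ c, G' →ₗ[ℝ] TangentSpace 𝓘(ℝ, E) (g c)}
  {f : P → ℝ} {q : C}

theorem TwoForm.IsSmooth.eventually_contMDiffAt_pairing (hη : η.IsSmooth)
    (hg : ContMDiff 𝓘(ℝ, F) 𝓘(ℝ, E) ∞ g) (hΛ : IsFrameNear F g Λ W q)
    (hΛ' : IsFrameNear F g Λ' W' q) :
    ∀ᶠ c in 𝓝 q, ∀ u, ContMDiffAt 𝓘(ℝ, F) 𝓘(ℝ, G' →L[ℝ] ℝ) ∞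
      (fun c => η.pairing (Λ c) (Λ' c) u) c := by
  filter_upwards [hΛ.smooth, hΛ'.smooth] with c hc hc' u
  exact contMDiffAt_clm_of_apply fun v => hη.contMDiffAt_apply hg.contMDiffAt (hc u) (hc' v)

variable [FiniteDimensional ℝ G]

/-- In frames, the equation `i_X η = d f` for `X` in `W` is a linear system whose rank is the
codimension of the polar of `W`. -/
theorem TwoForm.IsSmooth.exists_local_isHamiltonianVector (hη : η.IsSmooth)
    (hg : ContMDiff 𝓘(ℝ, F) 𝓘(ℝ, E) ∞ g) (hΛ : IsFrameNear F g Λ W q)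
    (hreg : HasConstantRankNear g (fun c => η.polar (W c)) q)
    (hf : ContMDiff 𝓘(ℝ, E) 𝓘(ℝ, ℝ) ∞ f) (hfW : ∀ c, DerivVanishesOn f (η.polar (W c))) :
    ∃ X : ∀ c, TangentSpace 𝓘(ℝ, E) (g c), ∀ᶠ c in 𝓝 q,
      IsSmoothAlongAt F g X c ∧ X c ∈ W c ∧ η.IsHamiltonianVector f (X c) := by
  have hT := isFrameNear_ofCoord hg q
  have hsurj := hT.range_eq.mono fun c hc => LinearMap.range_eq_top.1 hc
  let A (c : C) := η.pairing (Λ c) (ofCoord (E := E) (g q) (g c)).toLinearMap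
  let b (c : C) : E →L[ℝ] ℝ := mvfderiv 𝓘(ℝ, E) f (g c) ∘L ofCoord (g q) (g c)
  have hrank : ∀ᶠ c in 𝓝 q, Module.finrank ℝ (LinearMap.range (A c)) +
      Module.finrank ℝ (η.polar (W c)) = Module.finrank ℝ E := by
    filter_upwards [hsurj, hΛ.range_eq] with c hc hW
    exact hW ▸ TwoForm.finrank_range_pairing_add_finrank_polar (Λ c) hc
  obtain ⟨u, hu, hAu, -⟩ := exists_local_solution (A := A) (b := b)
    (hη.eventually_contMDiffAt_pairing hg hΛ hT)
    (hT.smooth.mono fun c hc => contMDiffAt_clm_of_apply fun v => (hc v).mvfderiv_apply hf)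
    (by
      filter_upwards [hrank, hreg] with c hc hcreg
      have := hrank.self_of_nhds
      omega)
    (by
      filter_upwards [hΛ.range_eq] with c hW
      obtain ⟨V, hV, hVf⟩ := TwoForm.exists_isHamiltonianVector_mem_iff.2 (hfW c)
      obtain ⟨w, rfl⟩ := hW ▸ hV
      exact ⟨w, ContinuousLinearMap.ext fun v => hVf _⟩)
  refine ⟨fun c => Λ c (u c), ?_⟩
  filter_upwards [hu, hAu, hΛ.smooth, hΛ.range_eq, hsurj] with c huc hAuc hΛc hW hc
  exact ⟨IsSmoothAlongAt.linearMap_apply hg.contMDiffAt hΛc huc, hW ▸ LinearMap.mem_range_self _ _,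
    hc.forall.2 fun v => DFunLike.congr_fun hAuc v⟩

theorem TwoForm.IsSmooth.exists_local_section_inf_polar (hη : η.IsSmooth)
    (hg : ContMDiff 𝓘(ℝ, F) 𝓘(ℝ, E) ∞ g) (hΛ : IsFrameNear F g Λ W q)
    (hΛ' : IsFrameNear F g Λ' W' q)
    (hreg : HasConstantRankNear g (fun c => W c ⊓ η.polar (W' c)) q)
    {V : TangentSpace 𝓘(ℝ, E) (g q)} (hV : V ∈ W q ⊓ η.polar (W' q)) :
    ∃ X : ∀ c, TangentSpace 𝓘(ℝ, E) (g c),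
      (∀ᶠ c in 𝓝 q, IsSmoothAlongAt F g X c ∧ X c ∈ W c ⊓ η.polar (W' c)) ∧ X q = V := by
  let A (c : C) := η.pairing (Λ c) (Λ' c)
  have hker : ∀ᶠ c in 𝓝 q, LinearMap.ker (A c) = (η.polar (W' c)).comap (Λ c) :=
    hΛ'.range_eq.mono fun c hW' => hW' ▸ TwoForm.ker_pairing (Λ c) (Λ' c)
  have hfinrank : ∀ᶠ c in 𝓝 q, Module.finrank ℝ (LinearMap.ker (A c)) =
      Module.finrank ℝ (W c ⊓ η.polar (W' c) : Submodule ℝ (TangentSpace 𝓘(ℝ, E) (g c))) := by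
    filter_upwards [hker, hΛ.injective, hΛ.range_eq] with c hc hinj hW
    rw [hc, finrank_comap_of_injective hinj, hW]
  obtain ⟨v, rfl⟩ := hΛ.range_eq.self_of_nhds ▸ hV.1
  have hv : v ∈ LinearMap.ker (A q) := hker.self_of_nhds ▸ hV.2
  obtain ⟨u, hu, hAu, rfl⟩ := exists_local_kernel_section
    (hη.eventually_contMDiffAt_pairing hg hΛ hΛ')
    (by
      filter_upwards [hfinrank, hreg] with c hc hcreg
      exact (hc.trans hcreg).trans hfinrank.self_of_nhds.symm)
    (LinearMap.mem_ker.1 hv)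
  refine ⟨fun c => Λ c (u c), ?_, rfl⟩
  filter_upwards [hu, hAu, hΛ.smooth, hΛ.range_eq, hker] with c huc hAuc hΛc hW hc
  exact ⟨IsSmoothAlongAt.linearMap_apply hg.contMDiffAt hΛc huc,
    hW ▸ LinearMap.mem_range_self _ _, hc.le (LinearMap.mem_ker.2 hAuc)⟩

end Pairing

section HamiltonianFields

variable {E : Type*} [NormedAddCommGroup E] [NormedSpace ℝ E]
  {P : Type*} [TopologicalSpace P] [ChartedSpace E P]
  {F : Type*} [NormedAddCommGroup F] [NormedSpace ℝ F]
  {C : Type*} [TopologicalSpace C] [ChartedSpace F C]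
  {G : Type*} [NormedAddCommGroup G] [NormedSpace ℝ G]
  {η : TwoForm E P} {ι : C → P} {f : P → ℝ} {q : C}

variable (F) in
/-- First class constraints with respect to an arbitrary 2-form. -/
def TwoForm.IsFirstClass (η : TwoForm E P) (ι : C → P) (f : P → ℝ) : Prop :=
  IsConstraint E ι f ∧ ∀ q : C, DerivVanishesOn f (η.polar (subTangent (F := F) ι q))

theorem TwoForm.IsFirstClass.exists_isHamiltonianVector [FiniteDimensional ℝ E]
    (hf : η.IsFirstClass F ι f) (hι : ContMDiff 𝓘(ℝ, F) 𝓘(ℝ, E) ∞ ι) (q : C) :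
    ∃ V ∈ subTangent (F := F) ι q ⊓ η.polar (subTangent (F := F) ι q),
      η.IsHamiltonianVector f V := by
  obtain ⟨V, hV, hVf⟩ := TwoForm.exists_isHamiltonianVector_mem_iff.2 (hf.2 q)
  exact ⟨V, ⟨hV, hVf.mem_polar_subTangent hf.1 hι⟩, hVf⟩

variable [IsManifold 𝓘(ℝ, E) ∞ P]

variable (F) in
/-- Hamiltonian vector fields along `C` with respect to an arbitrary 2-form. -/
def TwoForm.IsHamiltonianFieldAlong (η : TwoForm E P) (ι : C → P) (f : P → ℝ)
    (X : ∀ q : C, TangentSpace 𝓘(ℝ, E) (ι q)) : Prop :=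
  ∀ q, IsSmoothAlongAt F ι X q ∧ η.IsHamiltonianVector f (X q)

variable [FiniteDimensional ℝ E]

theorem TwoForm.IsSmooth.exists_isConstraint_isHamiltonianVector_smul [T2Space P]
    (hη : η.IsSmooth) (hι : IsSmoothEmbedding 𝓘(ℝ, F) 𝓘(ℝ, E) ∞ ι)
    {X : ∀ c, TangentSpace 𝓘(ℝ, E) (ι c)} (hX : ∀ᶠ c in 𝓝 q, IsSmoothAlongAt F ι X c)
    {N : Set C} (hN : N ∈ 𝓝 q) :
    ∃ (f : P → ℝ) (ρ : C → ℝ), IsConstraint E ι f ∧ ContMDiff 𝓘(ℝ, F) 𝓘(ℝ, ℝ) ∞ ρ ∧ ρ q = 1 ∧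
      tsupport ρ ⊆ N ∧ ∀ c, (ρ c ≠ 0 → X c ∈ η.polar (subTangent (F := F) ι c)) →
        η.IsHamiltonianVector f (ρ c • X c) := by
  obtain ⟨U, g, hU, hqU, hg, hgι⟩ := exists_local_constraint hι q
    (α := fun c => alternatingBilin (η (ι c)) (X c)) (by
      filter_upwards [hX, (isFrameNear_ofCoord hι.contMDiff q).smooth] with c hc hframe v
      exact hη.contMDiffAt_apply hι.contMDiff.contMDiffAt hc (hframe v))
  rw [hι.isEmbedding.nhds_eq_comap, mem_comap] at hN
  obtain ⟨t, ht, htN⟩ := hN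
  obtain ⟨f, ρ, hf, hρ, hρq, hρU, hfg⟩ := exists_isConstraint_mvfderiv_eq_smul (ι := ι)
    (hU.inter isOpen_interior) ⟨hqU, mem_interior_iff_mem_nhds.2 ht⟩ (hg.mono inter_subset_left)
    fun c hc => (hgι c hc.1).1
  refine ⟨f, ρ ∘ ι, hf, hρ.comp hι.contMDiff, hρq,
    (tsupport_comp_subset_preimage ρ hι.contMDiff.continuous).trans fun c hc =>
      htN (show ι c ∈ t from interior_subset (hρU hc).2), fun c hc W => ?_⟩
  change alternatingBilin (η (ι c)) (ρ (ι c) • X c) W = _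
  rw [hfg, map_smul]
  change ρ (ι c) * alternatingBilin (η (ι c)) (X c) W = ρ (ι c) * mvfderiv 𝓘(ℝ, E) g (ι c) W
  by_cases hρc : ρ (ι c) = 0
  · rw [hρc, zero_mul, zero_mul]
  · rw [(hgι c (hρU (subset_tsupport ρ hρc)).1).2 (TwoForm.mem_polar.1 (hc hρc)) W]

theorem TwoForm.IsSmooth.exists_isConstraint_isHamiltonianVector [T2Space P]
    (hη : η.IsSmooth) (hι : IsSmoothEmbedding 𝓘(ℝ, F) 𝓘(ℝ, E) ∞ ι)
    {V : TangentSpace 𝓘(ℝ, E) (ι q)} (hV : V ∈ η.polar (subTangent (F := F) ι q)) :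
    ∃ f, IsConstraint E ι f ∧ η.IsHamiltonianVector f V := by
  obtain ⟨X, hX, rfl⟩ := exists_isSmoothAlong_eq hι.contMDiff q V
  obtain ⟨f, ρ, hf, -, hρq, -, hfX⟩ :=
    hη.exists_isConstraint_isHamiltonianVector_smul hι hX univ_mem
  exact ⟨f, hf, by simpa [hρq] using hfX q fun _ => hV⟩

theorem TwoForm.IsSmooth.exists_isConstraint_isHamiltonianFieldAlong [T2Space P]
    [FiniteDimensional ℝ F] [FiniteDimensional ℝ G] [IsManifold 𝓘(ℝ, F) ∞ C] (hη : η.IsSmooth)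
    (hι : IsSmoothEmbedding 𝓘(ℝ, F) 𝓘(ℝ, E) ∞ ι)
    {Λ : ∀ c, G →ₗ[ℝ] TangentSpace 𝓘(ℝ, E) (ι c)}
    {W : ∀ c, Submodule ℝ (TangentSpace 𝓘(ℝ, E) (ι c))} (hΛ : IsFrameNear F ι Λ W q)
    (hreg : HasConstantRankNear ι (fun c => W c ⊓ η.polar (subTangent (F := F) ι c)) q)
    {V : TangentSpace 𝓘(ℝ, E) (ι q)} (hV : V ∈ W q ⊓ η.polar (subTangent (F := F) ι q)) :
    ∃ f X, IsConstraint E ι f ∧ η.IsHamiltonianFieldAlong F ι f X ∧ (∀ c, X c ∈ W c) ∧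
      X q = V := by
  obtain ⟨X, hX, rfl⟩ :=
    hη.exists_local_section_inf_polar hι.contMDiff hΛ (isFrameNear_subTangent hι q) hreg hV
  obtain ⟨f, ρ, hf, hρ, hρq, hρN, hfX⟩ :=
    hη.exists_isConstraint_isHamiltonianVector_smul hι (hX.mono fun c hc => hc.1) hX
  have hX_mem (c : C) (hc : ρ c ≠ 0) : X c ∈ W c ⊓ η.polar (subTangent (F := F) ι c) :=
    (hρN (subset_tsupport ρ hc)).2
  refine ⟨f, fun c => ρ c • X c, hf, fun c => ⟨isSmoothAlongAt_smul_of_tsupport hι.contMDiff hρ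
    (fun c hc => (hρN hc).1) c, hfX c fun hc => (hX_mem c hc).2⟩, fun c => ?_, by simp [hρq]⟩
  by_cases hc : ρ c = 0
  · simp [hc]
  · exact (W c).smul_mem _ (hX_mem c hc).1

theorem TwoForm.IsSmooth.exists_isHamiltonianFieldAlong [FiniteDimensional ℝ F]
    [FiniteDimensional ℝ G] [IsManifold 𝓘(ℝ, F) ∞ C] [T2Space C] [SigmaCompactSpace C]
    (hη : η.IsSmooth) {g : C → P} (hg : ContMDiff 𝓘(ℝ, F) 𝓘(ℝ, E) ∞ g)
    {W : ∀ c, Submodule ℝ (TangentSpace 𝓘(ℝ, E) (g c))}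
    (hW : ∀ q, ∃ Λ : ∀ c, G →ₗ[ℝ] TangentSpace 𝓘(ℝ, E) (g c), IsFrameNear F g Λ W q)
    (hreg : ∀ q, HasConstantRankNear g (fun c => η.polar (W c)) q)
    (hf : ContMDiff 𝓘(ℝ, E) 𝓘(ℝ, ℝ) ∞ f) (hfW : ∀ c, DerivVanishesOn f (η.polar (W c))) :
    ∃ X, η.IsHamiltonianFieldAlong F g f X ∧ ∀ c, X c ∈ W c := by
  obtain ⟨X, hX⟩ := exists_isSmoothAlong_forall_mem_convex hg
    (fun c => {V | V ∈ W c ∧ η.IsHamiltonianVector f V})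
    (fun c => TwoForm.convex_setOf_mem_isHamiltonianVector) fun q =>
      (hW q).elim fun Λ hΛ => hη.exists_local_isHamiltonianVector hg hΛ (hreg q) hf hfW
  exact ⟨X, fun c => ⟨(hX c).1, (hX c).2.2⟩, fun c => (hX c).2.1⟩

theorem TwoForm.IsSmooth.span_isHamiltonianVector [T2Space P] (hη : η.IsSmooth)
    (hι : IsSmoothEmbedding 𝓘(ℝ, F) 𝓘(ℝ, E) ∞ ι) :
    Submodule.span ℝ {V : TangentSpace 𝓘(ℝ, E) (ι q) |
        ∃ f, IsConstraint E ι f ∧ η.IsHamiltonianVector f V} =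
      η.polar (subTangent (F := F) ι q) := by
  refine le_antisymm (Submodule.span_le.2 ?_) fun V hV =>
    Submodule.subset_span (hη.exists_isConstraint_isHamiltonianVector hι hV)
  rintro V ⟨f, hf, hV⟩
  exact hV.mem_polar_subTangent hf hι.contMDiff

variable [FiniteDimensional ℝ F] [IsManifold 𝓘(ℝ, F) ∞ C]

theorem TwoForm.IsSmooth.span_isHamiltonianFieldAlong [T2Space P] (hη : η.IsSmooth)
    (hι : IsSmoothEmbedding 𝓘(ℝ, F) 𝓘(ℝ, E) ∞ ι)
    (hreg : HasConstantRankNear ι (fun c => η.polar (subTangent (F := F) ι c)) q) :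
    Submodule.span ℝ {V : TangentSpace 𝓘(ℝ, E) (ι q) |
        ∃ f X, IsConstraint E ι f ∧ η.IsHamiltonianFieldAlong F ι f X ∧ X q = V} =
      η.polar (subTangent (F := F) ι q) := by
  refine le_antisymm (Submodule.span_le.2 ?_) fun V hV => Submodule.subset_span ?_
  · rintro _ ⟨f, X, hf, hX, rfl⟩
    exact (hX q).2.mem_polar_subTangent hf hι.contMDiff
  · obtain ⟨f, X, hf, hX, -, hXV⟩ := hη.exists_isConstraint_isHamiltonianFieldAlong hι
      (isFrameNear_ofCoord hι.contMDiff q) (by simpa only [top_inf_eq] using hreg)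
      ⟨Submodule.mem_top, hV⟩
    exact ⟨f, X, hf, hX, hXV⟩

theorem TwoForm.IsSmooth.span_isHamiltonianFieldAlong_pushField [T2Space P] (hη : η.IsSmooth)
    (hι : IsSmoothEmbedding 𝓘(ℝ, F) 𝓘(ℝ, E) ∞ ι)
    (hreg : HasConstantRankNear ι
      (fun c => subTangent (F := F) ι c ⊓ η.polar (subTangent (F := F) ι c)) q) :
    Submodule.span ℝ {V : TangentSpace 𝓘(ℝ, E) (ι q) |
        ∃ (f : P → ℝ) (Y : ∀ c : C, TangentSpace 𝓘(ℝ, F) c),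
          η.IsFirstClass F ι f ∧ IsSmoothField Y ∧
          η.IsHamiltonianFieldAlong F ι f (pushField ι Y) ∧ pushField ι Y q = V} =
      subTangent (F := F) ι q ⊓ η.polar (subTangent (F := F) ι q) := by
  refine le_antisymm (Submodule.span_le.2 ?_) fun V hV => Submodule.subset_span ?_
  · rintro _ ⟨f, Y, hf, -, hY, rfl⟩
    exact ⟨⟨Y q, rfl⟩, (hY q).2.mem_polar_subTangent hf.1 hι.contMDiff⟩
  · obtain ⟨f, X, hf, hX, hX_tangent, rfl⟩ :=
      hη.exists_isConstraint_isHamiltonianFieldAlong hι (isFrameNear_subTangent hι q) hreg hV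
    obtain ⟨Y, hY, rfl⟩ := exists_pushField_eq hι (fun c => (hX c).1) hX_tangent
    have hf_firstClass (c : C) : DerivVanishesOn f (η.polar (subTangent (F := F) ι c)) :=
      TwoForm.exists_isHamiltonianVector_mem_iff.1 ⟨_, hX_tangent c, (hX c).2⟩
    exact ⟨f, Y, ⟨hf, hf_firstClass⟩, hY, hX, rfl⟩

variable [T2Space C] [SigmaCompactSpace C]

theorem TwoForm.IsSmooth.exists_isHamiltonianFieldAlong_iff (hη : η.IsSmooth)
    (hι : ContMDiff 𝓘(ℝ, F) 𝓘(ℝ, E) ∞ ι)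
    (hreg : ∀ q : C, HasConstantRankNear ι
      (fun c => η.polar (⊤ : Submodule ℝ (TangentSpace 𝓘(ℝ, E) (ι c)))) q)
    (hf : ContMDiff 𝓘(ℝ, E) 𝓘(ℝ, ℝ) ∞ f) :
    (∃ X, η.IsHamiltonianFieldAlong F ι f X) ↔
      ∀ c : C, DerivVanishesOn f (η.polar (⊤ : Submodule ℝ (TangentSpace 𝓘(ℝ, E) (ι c)))) := by
  refine ⟨fun ⟨X, hX⟩ c => TwoForm.exists_isHamiltonianVector_iff.1 ⟨X c, (hX c).2⟩, fun h => ?_⟩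
  obtain ⟨X, hX, -⟩ := hη.exists_isHamiltonianFieldAlong hι
    (fun q => ⟨_, isFrameNear_ofCoord hι q⟩) hreg hf h
  exact ⟨X, hX⟩

theorem TwoForm.IsSmooth.exists_isHamiltonianFieldAlong_pushField (hη : η.IsSmooth)
    (hι : IsSmoothEmbedding 𝓘(ℝ, F) 𝓘(ℝ, E) ∞ ι) (hf : η.IsFirstClass F ι f)
    (hreg : ∀ q : C, HasConstantRankNear ι (fun c => η.polar (subTangent (F := F) ι c)) q) :
    ∃ Y : ∀ c : C, TangentSpace 𝓘(ℝ, F) c, IsSmoothField Y ∧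
      η.IsHamiltonianFieldAlong F ι f (pushField ι Y) ∧
      ∀ c : C, pushField ι Y c ∈ η.polar (subTangent (F := F) ι c) := by
  obtain ⟨X, hX, hX_tangent⟩ := hη.exists_isHamiltonianFieldAlong hι.contMDiff
    (fun q => ⟨_, isFrameNear_subTangent hι q⟩) hreg hf.1.smooth hf.2
  obtain ⟨Y, hY, rfl⟩ := exists_pushField_eq hι (fun c => (hX c).1) hX_tangent
  exact ⟨Y, hY, hX, fun c => (hX c).2.mem_polar_subTangent hf.1 hι.contMDiff⟩

end HamiltonianFields

section Conversion

variable {E : Type*} [NormedAddCommGroup E] [NormedSpace ℝ E]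
  {P : Type*} [TopologicalSpace P] [ChartedSpace E P] {Ω : PresymplecticForm E P}
  {F : Type*} [NormedAddCommGroup F] [NormedSpace ℝ F]
  {C : Type*} [TopologicalSpace C] [ChartedSpace F C] {ι : C → P} {f : P → ℝ}

theorem PresymplecticForm.polar_eq {p : P} (W : Submodule ℝ (TangentSpace 𝓘(ℝ, E) p)) :
    Ω.polar W = Ω.form.polar W :=
  Submodule.ext fun _ => TwoForm.mem_polar.symm

theorem PresymplecticForm.isFirstClass_iff : Ω.IsFirstClass F ι f ↔ Ω.form.IsFirstClass F ι f := by
  simp only [TwoForm.IsFirstClass, ← PresymplecticForm.polar_eq]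
  exact ⟨fun h => ⟨h.1, h.2⟩, fun h => ⟨h.1, h.2⟩⟩

theorem PresymplecticForm.isHamiltonianFieldAlong_iff [IsManifold 𝓘(ℝ, E) ∞ P]
    {X : ∀ q : C, TangentSpace 𝓘(ℝ, E) (ι q)} :
    Ω.IsHamiltonianFieldAlong F ι f X ↔ Ω.form.IsHamiltonianFieldAlong F ι f X :=
  ⟨fun h q => ⟨h.smooth q, h.hamiltonian q⟩, fun h => ⟨fun q => (h q).1, fun q => (h q).2⟩⟩

end Conversion

theorem sigmaCompactSpace_of_isEmbedding (F : Type*) [NormedAddCommGroup F] [NormedSpace ℝ F]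
    [FiniteDimensional ℝ F] {C : Type*} [TopologicalSpace C] [ChartedSpace F C] {P : Type*}
    [TopologicalSpace P] [SecondCountableTopology P] {ι : C → P} (hι : IsEmbedding ι) :
    SigmaCompactSpace C := by
  have : SecondCountableTopology C := hι.secondCountableTopology
  have : LocallyCompactSpace C := Manifold.locallyCompact_of_finiteDimensional 𝓘(ℝ, F)
  infer_instance

end

theorem proposition6p12_general
    {E : Type*} [NormedAddCommGroup E] [NormedSpace ℝ E] [FiniteDimensional ℝ E]
    {P : Type*} [TopologicalSpace P] [T2Space P] [ChartedSpace E P] [IsManifold 𝓘(ℝ, E) ∞ P]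
    {η : TwoForm E P} (hη : η.IsSmooth)
    {F : Type*} [NormedAddCommGroup F] [NormedSpace ℝ F] [FiniteDimensional ℝ F]
    {C : Type*} [TopologicalSpace C] [SigmaCompactSpace C] [ChartedSpace F C]
    [IsManifold 𝓘(ℝ, F) ∞ C] {ι : C → P} (hι : IsSmoothEmbedding 𝓘(ℝ, F) 𝓘(ℝ, E) ∞ ι) :
    (∀ f : P → ℝ, IsConstraint E ι f →
      ((∀ q : C, ∃ V : TangentSpace 𝓘(ℝ, E) (ι q), η.IsHamiltonianVector f V) ↔
        ∀ q : C, DerivVanishesOn f (η.polar (⊤ : Submodule ℝ (TangentSpace 𝓘(ℝ, E) (ι q))))) ∧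
      ((∀ q : C, HasConstantRankNear ι
          (fun q' => η.polar (⊤ : Submodule ℝ (TangentSpace 𝓘(ℝ, E) (ι q')))) q) →
        ((∃ X, η.IsHamiltonianFieldAlong F ι f X) ↔
          ∀ q : C, DerivVanishesOn f
            (η.polar (⊤ : Submodule ℝ (TangentSpace 𝓘(ℝ, E) (ι q)))))) ∧
      (∀ (q : C) (V : TangentSpace 𝓘(ℝ, E) (ι q)), η.IsHamiltonianVector f V →
        V ∈ η.polar (subTangent (F := F) ι q))) ∧
    (∀ q : C,
      Submodule.span ℝ {V : TangentSpace 𝓘(ℝ, E) (ι q) |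
          ∃ f, IsConstraint E ι f ∧ η.IsHamiltonianVector f V} =
        η.polar (subTangent (F := F) ι q) ∧
      (HasConstantRankNear ι (fun q' => η.polar (subTangent (F := F) ι q')) q →
        Submodule.span ℝ {V : TangentSpace 𝓘(ℝ, E) (ι q) |
            ∃ f X, IsConstraint E ι f ∧ η.IsHamiltonianFieldAlong F ι f X ∧ X q = V} =
          η.polar (subTangent (F := F) ι q))) ∧
    (∀ f : P → ℝ, η.IsFirstClass F ι f →
      (∀ q : C, ∃ V ∈ subTangent (F := F) ι q ⊓ η.polar (subTangent (F := F) ι q),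
        η.IsHamiltonianVector f V) ∧
      ((∀ q : C, HasConstantRankNear ι (fun q' => η.polar (subTangent (F := F) ι q')) q) →
        ∃ Y : ∀ q : C, TangentSpace 𝓘(ℝ, F) q, IsSmoothField Y ∧
          η.IsHamiltonianFieldAlong F ι f (pushField ι Y) ∧
          ∀ q : C, pushField ι Y q ∈ η.polar (subTangent (F := F) ι q))) ∧
    (∀ q : C,
      HasConstantRankNear ι
        (fun q' => subTangent (F := F) ι q' ⊓ η.polar (subTangent (F := F) ι q')) q →
      Submodule.span ℝ {V : TangentSpace 𝓘(ℝ, E) (ι q) |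
          ∃ (f : P → ℝ) (Y : ∀ q : C, TangentSpace 𝓘(ℝ, F) q),
            η.IsFirstClass F ι f ∧ IsSmoothField Y ∧
            η.IsHamiltonianFieldAlong F ι f (pushField ι Y) ∧ pushField ι Y q = V} =
        subTangent (F := F) ι q ⊓ η.polar (subTangent (F := F) ι q)) := by
  have : T2Space C := hι.isEmbedding.t2Space
  have hιs := hι.contMDiff
  exact ⟨fun f hf => ⟨forall_congr' fun q => TwoForm.exists_isHamiltonianVector_iff,
      fun hreg => hη.exists_isHamiltonianFieldAlong_iff hιs hreg hf.smooth,
      fun q V hV => hV.mem_polar_subTangent hf hιs⟩,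
    fun q => ⟨hη.span_isHamiltonianVector hι, hη.span_isHamiltonianFieldAlong hι⟩,
    fun f hf => ⟨fun q => hf.exists_isHamiltonianVector hιs q,
      hη.exists_isHamiltonianFieldAlong_pushField hι hf⟩,
    fun q => hη.span_isHamiltonianFieldAlong_pushField hι⟩

theorem proposition6p12
    {E : Type*} [NormedAddCommGroup E] [NormedSpace ℝ E] [FiniteDimensional ℝ E]
    {P : Type*} [TopologicalSpace P] [T2Space P] [SecondCountableTopology P]
    [ChartedSpace E P] [IsManifold 𝓘(ℝ, E) ∞ P]
    (Ω : PresymplecticForm E P)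
    {F : Type*} [NormedAddCommGroup F] [NormedSpace ℝ F] [FiniteDimensional ℝ F]
    {C : Type*} [TopologicalSpace C] [ChartedSpace F C] [IsManifold 𝓘(ℝ, F) ∞ C]
    (ι : C → P) (hι : IsSmoothEmbedding 𝓘(ℝ, F) 𝓘(ℝ, E) ∞ ι) :
    -- (i), at each point, and for smooth vector fields where `TP^⊥` is regular
    (∀ f : P → ℝ, IsConstraint E ι f →
      ((∀ q : C, ∃ V : TangentSpace 𝓘(ℝ, E) (ι q), Ω.IsHamiltonianVector f V) ↔
        ∀ q : C, DerivVanishesOn f (Ω.polar (⊤ : Submodule ℝ (TangentSpace 𝓘(ℝ, E) (ι q))))) ∧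
      ((∀ q : C, HasConstantRankNear ι
          (fun q' => Ω.polar (⊤ : Submodule ℝ (TangentSpace 𝓘(ℝ, E) (ι q')))) q) →
        ((∃ X, Ω.IsHamiltonianFieldAlong F ι f X) ↔
          ∀ q : C, DerivVanishesOn f
            (Ω.polar (⊤ : Submodule ℝ (TangentSpace 𝓘(ℝ, E) (ι q)))))) ∧
      (∀ (q : C) (V : TangentSpace 𝓘(ℝ, E) (ι q)), Ω.IsHamiltonianVector f V →
        V ∈ Ω.polar (subTangent (F := F) ι q))) ∧
    -- (ii), at each point, and for smooth vector fields where `TC^⊥` is regular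
    (∀ q : C,
      Submodule.span ℝ {V : TangentSpace 𝓘(ℝ, E) (ι q) |
          ∃ f, IsConstraint E ι f ∧ Ω.IsHamiltonianVector f V} =
        Ω.polar (subTangent (F := F) ι q) ∧
      (HasConstantRankNear ι (fun q' => Ω.polar (subTangent (F := F) ι q')) q →
        Submodule.span ℝ {V : TangentSpace 𝓘(ℝ, E) (ι q) |
            ∃ f X, IsConstraint E ι f ∧ Ω.IsHamiltonianFieldAlong F ι f X ∧ X q = V} =
          Ω.polar (subTangent (F := F) ι q))) ∧
    -- (iii), at each point, and for smooth vector fields on `C` where `TC^⊥` is regular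
    (∀ f : P → ℝ, Ω.IsFirstClass F ι f →
      (∀ q : C, ∃ V ∈ subTangent (F := F) ι q ⊓ Ω.polar (subTangent (F := F) ι q),
        Ω.IsHamiltonianVector f V) ∧
      ((∀ q : C, HasConstantRankNear ι (fun q' => Ω.polar (subTangent (F := F) ι q')) q) →
        ∃ Y : ∀ q : C, TangentSpace 𝓘(ℝ, F) q, IsSmoothField Y ∧
          Ω.IsHamiltonianFieldAlong F ι f (pushField ι Y) ∧
          ∀ q : C, pushField ι Y q ∈ Ω.polar (subTangent (F := F) ι q))) ∧
    -- (iv), at the points near which `TC ∩ TC^⊥` is regular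
    (∀ q : C,
      HasConstantRankNear ι
        (fun q' => subTangent (F := F) ι q' ⊓ Ω.polar (subTangent (F := F) ι q')) q →
      Submodule.span ℝ {V : TangentSpace 𝓘(ℝ, E) (ι q) |
          ∃ (f : P → ℝ) (Y : ∀ q : C, TangentSpace 𝓘(ℝ, F) q),
            Ω.IsFirstClass F ι f ∧ IsSmoothField Y ∧
            Ω.IsHamiltonianFieldAlong F ι f (pushField ι Y) ∧ pushField ι Y q = V} =
        subTangent (F := F) ι q ⊓ Ω.polar (subTangent (F := F) ι q)) := by
  have : SigmaCompactSpace C := sigmaCompactSpace_of_isEmbedding F hι.isEmbedding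
  simp only [PresymplecticForm.isFirstClass_iff, PresymplecticForm.isHamiltonianFieldAlong_iff,
    PresymplecticForm.polar_eq]
  exact proposition6p12_general Ω.smooth hι
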